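/- Languages are subsets of $\Sigma^*$ with $\Sigma=\{0,1\}$, and a complexity class is a set of languages. Machines are oracle Turing machines with a polynomial clock that is independent of the oracles. Put $\Sigma_0^p=\Pi_0^p=\Delta_0^p=\mathrm{P}$ and, for $i>0$, $\Sigma_i^p=\mathrm{NP}^{\Sigma_{i-1}^p}$, $\Pi_i^p=\mathrm{co}\Sigma_i^p$, $\Delta_i^p=\mathrm{P}^{\Sigma_{i-1}^p}$ (so $\Delta_1^p=\mathrm{P}$). For complexity classes $\mathcal C,\mathcal D$, the following classes consist of the languages accepted, for some $C\in\mathcal C$ and $D\in\mathcal D$, by a deterministic polynomial-time oracle machine that is restricted to making: - $\mathrm{P}^{\mathcal C:\mathcal D}$: at most one query to $C$ followed by at most one query to $D$; - $\mathrm{P}_{1,1\text{-tt}}^{(\mathcal C,\mathcal D)}$: simultaneously at most one query to $C$ and at most one query to $D$; - $\mathrm{P}^{\mathcal C,\mathcal D}$: at most one query to $C$ and at most one query to $D$, in arbitrary order; - $\mathrm{P}^{\mathcal C[1],\mathcal D[poly]}$: at most one query to $C$ and polynomially many queries to $D$, in arbitrary order (the query to $C$ may come between queries to $D$). Corollary.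 1. For all $k\ge 0$ and $j>0$, $$\mathrm{P}_{1,1\text{-tt}}^{(\Delta_j^p,\Sigma_k^p)}=\mathrm{P}^{\Delta_j^p:\Sigma_k^p}=\mathrm{P}^{\Sigma_k^p:\Delta_j^p}=\mathrm{P}^{\Sigma_k^p,\Delta_j^p}=\begin{cases}\Delta_j^p&\text{if } j>k,\\ \mathrm{P}^{\Sigma_k^p[1],\Sigma_{j-1}^p[poly]}&\text{if } j\le k.\end{cases}$$ 2. For all $j,k\ge 0$, $$\mathrm{P}_{1,1\text{-tt}}^{(\Delta_j^p,\Sigma_k^p\cap\Pi_k^p)}=\mathrm{P}^{\Delta_j^p:\Sigma_k^p\cap\Pi_k^p}=\mathrm{P}^{\Sigma_k^p\cap\Pi_k^p:\Delta_j^p}=\mathrm{P}^{\Sigma_k^p\cap\Pi_k^p,\Delta_j^p}=\begin{cases}\Delta_j^p&\text{if } j>k,\\ \Sigma_k^p\cap\Pi_k^p&\text{if } j\le k.\end{cases}$$ 3. For all $j,k\ge 0$, $$\mathrm{P}_{1,1\text{-tt}}^{(\Sigma_j^p\cap\Pi_j^p,\Sigma_k^p\cap\Pi_k^p)}=\mathrm{P}^{\Sigma_j^p\cap\Pi_j^p:\Sigma_k^p\cap\Pi_k^p}=\mathrm{P}^{\Sigma_k^p\cap\Pi_k^p:\Sigma_j^p\cap\Pi_j^p}=\mathrm{P}^{\Sigma_k^p\cap\Pi_k^p,\Sigma_j^p\cap\Pi_j^p}=\Sigma_{\max(j,k)}^p\cap\Pi_{\max(j,k)}^p.$$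 -/

import Mathlib

namespace QueryOrder

/-- Subsets of `Σ*`, where `Σ = {0, 1}`. -/
abbrev Lang := Set (List Bool)

/-- A complexity class is any collection of subsets of `Σ*`. -/
abbrev CClass := Set Lang

/-- The class `co C` of complements of members of `C`. -/
def co (C : CClass) : CClass := {L | Lᶜ ∈ C}

/-! ### Oracle Turing machines

As in Mathlib's `Turing.TM2`, the storage of a machine consists of finitely many stacks (a tape with
a two-way head is a pair of stacks: the part to the left of the head and the part from the head on).
One instruction is executed per time step.  `ι` is the set of oracles, and `κ` is the set of
alternatives of a branching step: `Unit` for deterministic machines, `Bool` for nondeterministic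
ones. -/

/-- The instruction attached to a control state; `K` is the set of stacks, `Q` that of states. -/
inductive Instr (ι κ K Q : Type) where
  /-- write a symbol on top of a stack -/
  | push (k : K) (b : Bool) (next : Q)
  /-- remove and read the top symbol of a stack (`none` if the stack is empty) -/
  | pop (k : K) (next : Option Bool → Q)
  /-- go to one of the states `next c` -/
  | branch (next : κ → Q)
  /-- query, simultaneously, every oracle `i ∈ S` about the word on its query stack -/
  | query (S : Finset ι) (next : (ι → Bool) → Q)
  /-- stop, and accept or reject -/
  | halt (accept : Bool)

/-- An oracle Turing machine with oracles indexed by `ι` and branching alternatives `κ`. -/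
structure OTM (ι κ : Type) where
  /-- control states -/
  Q : Type
  /-- stacks -/
  K : Type
  [finQ : Finite Q]
  [finK : Finite K]
  [decK : DecidableEq K]
  /-- initial state -/
  start : Q
  /-- the stack that holds the input -/
  inp : K
  /-- the stack that holds the queries to each oracle -/
  qry : ι → K
  /-- the program -/
  instr : Q → Instr ι κ K Q

attribute [instance] OTM.decK OTM.finQ OTM.finK

namespace OTM

variable {ι κ : Type}

/-- Configurations.  The words on the stacks are read from the top.  The component `log` is not
accessible to the machine: it lists, in chronological order, the query steps made so far, each
represented by the set of oracles that it queries. -/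
structure Cfg (M : OTM ι κ) where
  state : M.Q
  stk : M.K → List Bool
  log : List (Finset ι)

variable (M : OTM ι κ)

/-- The initial configuration on input `x`. -/
def initCfg (x : List Bool) : M.Cfg where
  state := M.start
  stk := Function.update (fun _ => []) M.inp x
  log := []

open Classical in
/-- One step with oracles `A`, where `c` is the alternative taken if the step is a branching step.
A query step answers the queries and empties the query stacks that were used; a halted machine does
not move. -/
noncomputable def step (A : ι → Lang) (c : κ) (s : M.Cfg) : M.Cfg :=
  match M.instr s.state with
  | .push k b q => { s with state := q, stk := Function.update s.stk k (b :: s.stk k) }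
  | .pop k next =>
      { s with state := next (s.stk k).head?, stk := Function.update s.stk k (s.stk k).tail }
  | .branch next => { s with state := next c }
  | .query S next =>
      { state := next (fun i => decide (i ∈ S ∧ s.stk (M.qry i) ∈ A i))
        stk := fun k => if ∃ i ∈ S, M.qry i = k then [] else s.stk k
        log := s.log ++ [S] }
  | .halt _ => s

/-- The configuration reached after `t` steps on input `x` along the branch `c`. -/
noncomputable def run (A : ι → Lang) (c : ℕ → κ) (x : List Bool) : ℕ → M.Cfg
  | 0 => M.initCfg x
  | t + 1 => M.step A (c t) (run A c x t)

/-- The machine has a polynomial clock, independent of the oracles (and valid on all branches). -/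
def PolyTime : Prop :=
  ∃ p : Polynomial ℕ, ∀ (A : ι → Lang) (c : ℕ → κ) (x : List Bool),
    ∃ b, M.instr (M.run A c x (p.eval x.length)).state = .halt b

/-- The machine is restricted to computations whose sequence of query steps satisfies `R`. -/
def Restricted (R : List (Finset ι) → Prop) : Prop :=
  ∀ (A : ι → Lang) (c : ℕ → κ) (x : List Bool) (t : ℕ), R (M.run A c x t).log

/-- The language accepted with oracles `A`: the inputs with an accepting computation. -/
def language (A : ι → Lang) : Lang :=
  {x | ∃ (c : ℕ → κ) (t : ℕ), M.instr (M.run A c x t).state = .halt true}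

end OTM

/-- Deterministic oracle machines with oracles `ι`. -/
abbrev DTM (ι : Type) := OTM ι Unit

/-- Nondeterministic oracle machines with oracles `ι`. -/
abbrev NTM (ι : Type) := OTM ι Bool

/-! ### The polynomial hierarchy -/

/-- The class `P`. -/
def P : CClass := {L | ∃ M : DTM Empty, M.PolyTime ∧ L = M.language Empty.elim}

/-- The class `P^C`. -/
def PRel (C : CClass) : CClass :=
  {L | ∃ A ∈ C, ∃ M : DTM Unit, M.PolyTime ∧ L = M.language (fun _ => A)}

/-- The class `NP^C`. -/
def NPRel (C : CClass) : CClass :=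
  {L | ∃ A ∈ C, ∃ M : NTM Unit, M.PolyTime ∧ L = M.language (fun _ => A)}

/-- `Σ_i^p`. -/
def SigmaP : ℕ → CClass
  | 0 => P
  | i + 1 => NPRel (SigmaP i)

/-- `Π_i^p`. -/
def PiP : ℕ → CClass
  | 0 => P
  | i + 1 => co (SigmaP (i + 1))

/-- `Δ_i^p`. -/
def DeltaP : ℕ → CClass
  | 0 => P
  | i + 1 => PRel (SigmaP i)

/-! ### Classes given by restricted access to two oracles

Oracle `0` is taken from `C` and oracle `1` from `D`. -/

/-- The languages `L(M^{A, B})` with `A ∈ C`, `B ∈ D` and `M` a deterministic polynomial-time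
machine whose query steps are restricted by `R`. -/
def PTwo (R : List (Finset (Fin 2)) → Prop) (C D : CClass) : CClass :=
  {L | ∃ A ∈ C, ∃ B ∈ D, ∃ M : DTM (Fin 2), M.PolyTime ∧ M.Restricted R ∧ L = M.language ![A, B]}

/-- `P^{C:D}`: at most one query to `C` followed by at most one query to `D`. -/
def POrdered (C D : CClass) : CClass :=
  PTwo (fun l => l.Sublist [{0}, {1}]) C D

/-- `P_{1,1-tt}^{(C,D)}`: simultaneously at most one query to `C` and at most one query to `D`. -/
def PParallel (C D : CClass) : CClass :=
  PTwo (fun l => l.length ≤ 1) C D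

/-- `P^{C,D}`: at most one query to `C` and at most one query to `D`, in arbitrary order. -/
def PAnyOrder (C D : CClass) : CClass :=
  PTwo (fun l => l.Sublist [{0}, {1}] ∨ l.Sublist [{1}, {0}]) C D

/-- `P^{C[1],D[poly]}`: at most one query to `C` and any number of queries to `D` (polynomially
many, by the clock), in arbitrary order. -/
def POnePoly (C D : CClass) : CClass :=
  PTwo (fun l => (∀ S ∈ l, S = {0} ∨ S = {1}) ∧ l.count {0} ≤ 1) C D

end QueryOrder

/-! Two closure arguments carry the theorem, both for a machine `M` that queries a given oracle at
most once. A single query to `A ∈ Σ_k^p`, beside any number of queries to a language in `Δ_j^p` with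
`0 < j ≤ k`, has limited effect (`exists_symmDiff`). Let `L₀` and `L₁` be the languages obtained
when every query to `A` is answered "no" or "yes" respectively; both lie in `Δ_j^p`. Let `W` be the
set of inputs on which the run with answer "yes" asks only about members of `A`; it lies in `Σ_k^p`.
The language is `L₁` on `W` and `L₀` off `W`, hence equals the symmetric difference of `L₀` and `W ∩
(L₀ ∆ L₁)`. Conversely a symmetric difference of a language in `Δ_j^p` and one in `Σ_k^p` is decided
by one query to each, in either order or in parallel. So all classes in the first statement,
including `POnePoly`, are the class of these symmetric differences when `j ≤ k`. One query to each
of two languages in `Σ_k^p ∩ Π_k^p` stays in that class (`language_mem_sigma_inter_pi`): guess both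
answers, run `M` with them, and verify each guess, a "yes" by membership and a "no" by membership in
the complement. The complement is treated in the same way. The remaining cases follow from the
inclusions in the hierarchy and the closure of `Δ_{m+1}^p` under polynomial-time computation
(`language_mem_delta`). At the level of machines everything rests on one construction,
`Substitution`: queries of an outer machine are answered by running inner machines, which may
decline to answer. Its main consequence is `verifiedLanguage_mem_sigma`: outcomes of a
polynomial-time machine whose answers can be verified with an oracle in `Σ_m^p` define a language in
`Σ_{m+1}^p`. -/

namespace QueryOrder

/-! ### Runs from arbitrary configurations, and bounded computation trees. -/

namespace OTM

variable {ι κ : Type} (M : OTM ι κ)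

/-- The configuration reached from `s` after `t` steps along the branch `c`. -/
noncomputable def runFrom (A : ι → Lang) (c : ℕ → κ) (s : M.Cfg) : ℕ → M.Cfg
  | 0 => s
  | t + 1 => M.step A (c t) (runFrom A c s t)

theorem run_eq_runFrom (A : ι → Lang) (c : ℕ → κ) (x : List Bool) (t : ℕ) :
    M.run A c x t = M.runFrom A c (M.initCfg x) t := by
  induction t with
  | zero => rfl
  | succ t ih => simp only [run, runFrom, ih]

theorem runFrom_succ (A : ι → Lang) (c : ℕ → κ) (s : M.Cfg) (t : ℕ) :
    M.runFrom A c s (t + 1) = M.runFrom A (fun n => c (n + 1)) (M.step A (c 0) s) t := by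
  induction t with
  | zero => rfl
  | succ t ih =>
    rw [runFrom, ih]
    rfl

variable {M}

theorem step_of_halt {A : ι → Lang} {c : κ} {s : M.Cfg} {b : Bool}
    (hs : M.instr s.state = .halt b) : M.step A c s = s := by
  simp only [step, hs]

theorem runFrom_of_halt {A : ι → Lang} {c : ℕ → κ} {s : M.Cfg} {b : Bool}
    (hs : M.instr s.state = .halt b) (t : ℕ) : M.runFrom A c s t = s := by
  induction t with
  | zero => rfl
  | succ t ih => rw [runFrom, ih, step_of_halt hs]

theorem runFrom_add (A : ι → Lang) (c : ℕ → κ) (s : M.Cfg) (t u : ℕ) :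
    M.runFrom A c s (t + u) =
      M.runFrom A (fun n => c (t + n)) (M.runFrom A c s t) u := by
  induction u with
  | zero => rfl
  | succ u ih => rw [← add_assoc, runFrom, ih, runFrom]

theorem run_of_halt {A : ι → Lang} {c : ℕ → κ} {x : List Bool} {b : Bool} {t u : ℕ} (htu : t ≤ u)
    (hs : M.instr (M.run A c x t).state = .halt b) : M.run A c x u = M.run A c x t := by
  obtain ⟨v, rfl⟩ := Nat.exists_eq_add_of_le htu
  rw [run_eq_runFrom] at hs
  rw [run_eq_runFrom, run_eq_runFrom, runFrom_add, runFrom_of_halt hs]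

variable (M)

/-- If the next step of `s` is a query step, then the words queried belong to `V`. -/
def Verified (V : ι → Lang) (s : M.Cfg) : Prop :=
  ∀ S next, M.instr s.state = .query S next → ∀ i ∈ S, s.stk (M.qry i) ∈ V i

/-- The inputs that have a halting computation whose outcome satisfies `ψ` and whose queries all
belong to `V`. -/
def verifiedLanguage (A V : ι → Lang) (ψ : Bool → Prop) : Lang :=
  {x | ∃ (c : ℕ → κ) (t : ℕ) (b : Bool), M.instr (M.run A c x t).state = .halt b ∧ ψ b ∧
    ∀ u < t, M.Verified V (M.run A c x u)}

/-- `M.Evaluates A V safe ψ n s φ`: all computations from `s` halt within `n` steps with a `safe`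
outcome, and `φ` says that there is one whose outcome satisfies `ψ` and whose queries belong to
`V`. -/
inductive Evaluates (A V : ι → Lang) (safe ψ : Bool → Prop) : ℕ → M.Cfg → Prop → Prop
  | halt {n : ℕ} {s : M.Cfg} {b : Bool} : M.instr s.state = .halt b → safe b →
      Evaluates A V safe ψ n s (ψ b)
  | step {n : ℕ} {s : M.Cfg} {φ : κ → Prop} : (∀ b, M.instr s.state ≠ .halt b) →
      (∀ c, Evaluates A V safe ψ n (M.step A c s) (φ c)) →
      Evaluates A V safe ψ (n + 1) s (M.Verified V s ∧ ∃ c, φ c)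

variable {M}

theorem verified_univ (s : M.Cfg) : M.Verified (fun _ => Set.univ) s :=
  fun _ _ _ _ _ => Set.mem_univ _

theorem verified_of_halt {V : ι → Lang} {s : M.Cfg} {b : Bool}
    (hs : M.instr s.state = .halt b) : M.Verified V s := by
  intro S next h
  rw [hs] at h
  cases h

theorem language_eq_verifiedLanguage (A : ι → Lang) :
    M.language A = M.verifiedLanguage A (fun _ => Set.univ) (· = true) := by
  ext x
  constructor
  · rintro ⟨c, t, h⟩
    exact ⟨c, t, true, h, rfl, fun _ _ => verified_univ _⟩
  · rintro ⟨c, t, b, h, rfl, -⟩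
    exact ⟨c, t, h⟩

namespace Evaluates

variable {A V : ι → Lang} {safe ψ : Bool → Prop} {n m : ℕ} {s s' : M.Cfg} {φ : Prop}

theorem mono (h : M.Evaluates A V safe ψ n s φ) (hnm : n ≤ m) :
    M.Evaluates A V safe ψ m s φ := by
  induction h generalizing m with
  | halt h1 h2 => exact .halt h1 h2
  | step h1 _ ih =>
    obtain ⟨m, rfl⟩ : ∃ k, m = k + 1 := ⟨m - 1, by omega⟩
    exact .step h1 fun c => ih c (by omega)

theorem deterministic [Nonempty κ] (hs : ∀ b, M.instr s.state ≠ .halt b)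
    (hstep : ∀ c, M.step A c s = s')
    (h : M.Evaluates A (fun _ => Set.univ) safe ψ n s' φ) :
    M.Evaluates A (fun _ => Set.univ) safe ψ (n + 1) s φ := by
  have := Evaluates.step (A := A) (V := fun _ => Set.univ) (safe := safe) (ψ := ψ) (n := n)
    (s := s) (φ := fun _ => φ) hs (fun c => by rw [hstep c]; exact h)
  simpa [verified_univ] using this

/-- A branch from `s` is a first choice followed by a branch from the successor, so the existential
over branches unfolds into the recursive form of `Evaluates.step`. -/
theorem of_halts [Nonempty κ] {n : ℕ} {s : M.Cfg}
    (h : ∀ c : ℕ → κ, ∃ b, M.instr (M.runFrom A c s n).state = .halt b ∧ safe b) :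
    M.Evaluates A V safe ψ n s (∃ (c : ℕ → κ) (b : Bool),
      M.instr (M.runFrom A c s n).state = .halt b ∧ ψ b ∧
        ∀ u < n, M.Verified V (M.runFrom A c s u)) := by
  obtain ⟨k⟩ := ‹Nonempty κ›
  induction n generalizing s with
  | zero =>
    obtain ⟨b, hb, hsafe⟩ := h fun _ => k
    convert Evaluates.halt (s := s) (n := 0) (ψ := ψ) (A := A) (V := V) hb hsafe using 1
    constructor
    · rintro ⟨c, b', h1, h2, -⟩
      cases hb.symm.trans h1
      exact h2
    · exact fun h => ⟨fun _ => k, b, hb, h, by simp⟩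
  | succ n ih =>
    by_cases hs : ∃ b, M.instr s.state = .halt b
    · obtain ⟨b, hb⟩ := hs
      have hr : ∀ (c : ℕ → κ) t, M.runFrom A c s t = s := fun c t => runFrom_of_halt hb t
      obtain ⟨b', hb', hsafe⟩ := h fun _ => k
      rw [hr, hb] at hb'
      cases hb'
      convert Evaluates.halt (n := n + 1) (ψ := ψ) (A := A) (V := V) hb hsafe using 1
      simp only [hr, hb]
      constructor
      · rintro ⟨_, b', h1, h2, -⟩
        cases h1
        exact h2
      · exact fun h => ⟨fun _ => k, b, rfl, h, fun _ _ => verified_of_halt hb⟩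
    · push Not at hs
      have key : ∀ c, M.Evaluates A V safe ψ n (M.step A c s) (∃ (d : ℕ → κ) (b : Bool),
          M.instr (M.runFrom A d (M.step A c s) n).state = .halt b ∧ ψ b ∧
            ∀ u < n, M.Verified V (M.runFrom A d (M.step A c s) u)) := by
        refine fun c => ih fun d => ?_
        have := h fun t => Nat.casesOn t c d
        rwa [runFrom_succ] at this
      convert Evaluates.step hs key using 1
      constructor
      · rintro ⟨c, b, h1, h2, h3⟩
        rw [runFrom_succ] at h1
        refine ⟨h3 0 (by omega), c 0, _, b, h1, h2, fun u hu => ?_⟩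
        have := h3 (u + 1) (by omega)
        rwa [runFrom_succ] at this
      · rintro ⟨h0, c, d, b, h1, h2, h3⟩
        refine ⟨fun t => Nat.casesOn t c d, b, by rwa [runFrom_succ], h2, fun u hu => ?_⟩
        cases u with
        | zero => exact h0
        | succ u =>
          rw [runFrom_succ]
          exact h3 u (by omega)

theorem sound [Nonempty κ] (h : M.Evaluates A V safe ψ n s φ) :
    (∀ c : ℕ → κ, ∃ b, M.instr (M.runFrom A c s n).state = .halt b ∧ safe b) ∧
      (φ ↔ ∃ (c : ℕ → κ) (b : Bool),
        M.instr (M.runFrom A c s n).state = .halt b ∧ ψ b ∧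
          ∀ u < n, M.Verified V (M.runFrom A c s u)) := by
  obtain ⟨k⟩ := ‹Nonempty κ›
  induction h with
  | halt hb hsafe =>
    rename_i n s b
    have hr : ∀ (c : ℕ → κ) t, M.runFrom A c s t = s := fun c t => runFrom_of_halt hb t
    simp only [hr, hb]
    refine ⟨fun _ => ⟨b, rfl, hsafe⟩, ?_⟩
    constructor
    · exact fun h => ⟨fun _ => k, b, rfl, h, fun _ _ => verified_of_halt hb⟩
    · rintro ⟨_, b', h1, h2, -⟩
      cases h1
      exact h2
  | step hs _ ih =>
    constructor
    · intro c
      rw [runFrom_succ]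
      exact (ih (c 0)).1 _
    · constructor
      · rintro ⟨h0, c, hc⟩
        obtain ⟨d, b, h1, h2, h3⟩ := (ih c).2.1 hc
        refine ⟨fun t => Nat.casesOn t c d, b, by rwa [runFrom_succ], h2, fun u hu => ?_⟩
        cases u with
        | zero => exact h0
        | succ u =>
          rw [runFrom_succ]
          exact h3 u (by omega)
      · rintro ⟨c, b, h1, h2, h3⟩
        rw [runFrom_succ] at h1
        refine ⟨h3 0 (by omega), c 0, (ih (c 0)).2.2 ⟨_, b, h1, h2, fun u hu => ?_⟩⟩
        have := h3 (u + 1) (by omega)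
        rwa [runFrom_succ] at this

end Evaluates

/-- A halted configuration does not move and makes no query, so any halting time may be replaced by
the common bound `n`. -/
theorem verifiedLanguage_iff_of_halts {A V : ι → Lang} {ψ : Bool → Prop} {x : List Bool} {n : ℕ}
    (hn : ∀ c, ∃ b, M.instr (M.run A c x n).state = .halt b) :
    x ∈ M.verifiedLanguage A V ψ ↔ ∃ (c : ℕ → κ) (b : Bool),
      M.instr (M.run A c x n).state = .halt b ∧ ψ b ∧
        ∀ u < n, M.Verified V (M.run A c x u) := by
  constructor
  · rintro ⟨c, t, b, h1, h2, h3⟩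
    obtain ⟨b', hb'⟩ := hn c
    have ht : M.run A c x n = M.run A c x t := by
      rcases le_total t n with h | h
      · exact run_of_halt h h1
      · exact (run_of_halt h hb').symm
    refine ⟨c, b, by rw [ht, h1], h2, fun u hu => ?_⟩
    by_cases hut : u < t
    · exact h3 u hut
    · rw [run_of_halt (not_lt.1 hut) h1]
      exact verified_of_halt h1
  · rintro ⟨c, b, h1, h2, h3⟩
    exact ⟨c, n, b, h1, h2, h3⟩

/-- Computations that halt within `n` steps are evaluated. -/
theorem evaluates_of_halts [Nonempty κ] {A V : ι → Lang} {safe ψ : Bool → Prop} {x : List Bool}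
    {n : ℕ} (hn : ∀ c, ∃ b, M.instr (M.run A c x n).state = .halt b)
    (hsafe : ∀ c b, M.instr (M.run A c x n).state = .halt b → safe b) :
    M.Evaluates A V safe ψ n (M.initCfg x) (x ∈ M.verifiedLanguage A V ψ) := by
  rw [verifiedLanguage_iff_of_halts hn]
  simp only [run_eq_runFrom] at hn hsafe ⊢
  apply Evaluates.of_halts
  intro c
  obtain ⟨b, hb⟩ := hn c
  exact ⟨b, hb, hsafe c b hb⟩

/-- An evaluation of the initial configuration decides membership in the language. -/
theorem halts_and_mem_language_iff [Nonempty κ] {A : ι → Lang} {safe : Bool → Prop} {x : List Bool}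
    {n : ℕ} {φ : Prop}
    (h : M.Evaluates A (fun _ => Set.univ) safe (· = true) n (M.initCfg x) φ) :
    (∀ c, ∃ b, M.instr (M.run A c x n).state = .halt b) ∧ (x ∈ M.language A ↔ φ) := by
  obtain ⟨h1, h2⟩ := h.sound
  simp only [← run_eq_runFrom] at h1 h2
  have h3 : ∀ c, ∃ b, M.instr (M.run A c x n).state = .halt b :=
    fun c => (h1 c).imp fun _ => And.left
  refine ⟨h3, ?_⟩
  rw [language_eq_verifiedLanguage, verifiedLanguage_iff_of_halts h3, h2]

end OTM

/-! ### Answering the queries of one machine by running other machines. -/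

/-- The data from which the machine that answers the queries of `outer` by running the machines
`inner i` is built. -/
structure Substitution (ι ι₁ ι' κ₁ κ : Type) (κ₂ : ι → Type) where
  /-- the machine whose queries are answered -/
  outer : OTM ι κ₁
  /-- the machines that answer them -/
  inner (i : ι) : OTM ι₁ (κ₂ i)
  /-- the oracle that replaces an oracle of `inner i` -/
  oracle : ι → ι₁ → ι'
  /-- the alternative of a branching step of `outer` -/
  outerChoice : κ → κ₁
  /-- the alternative of a branching step of `inner i` -/
  innerChoice (i : ι) : κ → κ₂ i
  /-- the answer to a query that is deduced from the outcome of `inner i`; the computation is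
  given up if there is none -/
  answer : ι → Bool → Option Bool
  /-- the outcome that replaces an outcome of `outer` -/
  outcome : Bool → Bool

namespace Substitution

variable {ι ι₁ ι' κ₁ κ : Type} {κ₂ : ι → Type} (D : Substitution ι ι₁ ι' κ₁ κ κ₂)

/-- The stacks on which the inner machines work: one query stack for every oracle, and the other
stacks of the machines. -/
abbrev InnerStack := ι' ⊕ (Σ i, (D.inner i).K)

/-- The stacks of the combined machine; the last one is used to copy words. -/
abbrev Stack := D.outer.K ⊕ D.InnerStack ⊕ Unit

open Classical in
/-- The stack that plays the role of the stack `k` of `inner i`. -/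
noncomputable def embed (i : ι) (k : (D.inner i).K) : D.InnerStack :=
  if h : ∃ j, (D.inner i).qry j = k then .inl (D.oracle i h.choose) else .inr ⟨i, k⟩

/-- An inner machine has at most one oracle, so the index chosen in `embed` is the right one. With
two oracles sharing a query stack this could fail. -/
theorem embed_qry [Subsingleton ι₁] (i : ι) (j : ι₁) :
    D.embed i ((D.inner i).qry j) = .inl (D.oracle i j) := by
  have h : ∃ j', (D.inner i).qry j' = (D.inner i).qry j := ⟨j, rfl⟩
  rw [embed, dif_pos h, Subsingleton.elim h.choose j]

theorem embed_injective [Subsingleton ι₁] (i : ι) : Function.Injective (D.embed i) := by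
  intro k k' hk
  by_cases h : ∃ j, (D.inner i).qry j = k <;> by_cases h' : ∃ j, (D.inner i).qry j = k'
  · obtain ⟨j, rfl⟩ := h
    obtain ⟨j', rfl⟩ := h'
    rw [Subsingleton.elim j j']
  · rw [embed, embed, dif_pos h, dif_neg h'] at hk
    cases hk
  · rw [embed, embed, dif_neg h, dif_pos h'] at hk
    cases hk
  · rw [embed, embed, dif_neg h, dif_neg h'] at hk
    cases hk
    rfl

/-- The query step of `outer` that is being carried out: the state of `outer`, the queries that have
not been answered yet, and the answers so far. -/
abbrev Task := D.outer.Q × Finset ι × (ι → Bool)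

/-- States of the combined machine. -/
inductive State
  /-- `outer` works, or the next query of a query step of `outer` is taken up -/
  | main (r : D.outer.Q ⊕ D.Task)
  /-- empty the stacks in `T` -/
  | clear (T : Finset D.Stack) (r : D.outer.Q ⊕ D.Task)
  /-- move the query to the auxiliary stack -/
  | unload (x : D.Task) (i : ι)
  | unloadPush (x : D.Task) (i : ι) (b : Bool)
  /-- move the query from the auxiliary stack to its stack and to the input stack of `inner i` -/
  | load (x : D.Task) (i : ι)
  | loadPush (x : D.Task) (i : ι) (b : Bool)
  | loadPush' (x : D.Task) (i : ι) (b : Bool)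
  /-- `inner i` works -/
  | work (x : D.Task) (i : ι) (q : (D.inner i).Q)

instance [Finite ι] [Finite ι'] : Finite D.State := by
  let F : (D.outer.Q ⊕ D.Task) ⊕ (Finset D.Stack × (D.outer.Q ⊕ D.Task)) ⊕
      (D.Task × ι) ⊕ (D.Task × ι × Bool) ⊕ (D.Task × ι) ⊕ (D.Task × ι × Bool) ⊕
      (D.Task × ι × Bool) ⊕ (D.Task × Σ i, (D.inner i).Q) → D.State
    | .inl r => .main r
    | .inr (.inl (T, r)) => .clear T r
    | .inr (.inr (.inl (x, i))) => .unload x i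
    | .inr (.inr (.inr (.inl (x, i, b)))) => .unloadPush x i b
    | .inr (.inr (.inr (.inr (.inl (x, i))))) => .load x i
    | .inr (.inr (.inr (.inr (.inr (.inl (x, i, b)))))) => .loadPush x i b
    | .inr (.inr (.inr (.inr (.inr (.inr (.inl (x, i, b))))))) => .loadPush' x i b
    | .inr (.inr (.inr (.inr (.inr (.inr (.inr (x, ⟨i, q⟩))))))) => .work x i q
  refine Finite.of_surjective F ?_
  rintro (r | ⟨T, r⟩ | ⟨x, i⟩ | ⟨x, i, b⟩ | ⟨x, i⟩ | ⟨x, i, b⟩ | ⟨x, i, b⟩ | ⟨x, i, q⟩)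
  · exact ⟨.inl r, rfl⟩
  · exact ⟨.inr (.inl (T, r)), rfl⟩
  · exact ⟨.inr (.inr (.inl (x, i))), rfl⟩
  · exact ⟨.inr (.inr (.inr (.inl (x, i, b)))), rfl⟩
  · exact ⟨.inr (.inr (.inr (.inr (.inl (x, i))))), rfl⟩
  · exact ⟨.inr (.inr (.inr (.inr (.inr (.inl (x, i, b)))))), rfl⟩
  · exact ⟨.inr (.inr (.inr (.inr (.inr (.inr (.inl (x, i, b))))))), rfl⟩
  · exact ⟨.inr (.inr (.inr (.inr (.inr (.inr (.inr (x, ⟨i, q⟩))))))), rfl⟩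

open Classical in
/-- The stacks that have to be emptied after a query step of `outer`. -/
noncomputable def querySet (S : Finset ι) : Finset D.Stack :=
  S.image fun i => .inl (D.outer.qry i)

/-- The stacks that have to be emptied after a run of an inner machine. -/
noncomputable def innerSet [Finite ι] [Finite ι'] : Finset D.Stack :=
  (Set.toFinite (Set.range fun k : D.InnerStack => (.inr (.inl k) : D.Stack))).toFinset

variable [LinearOrder ι] [Finite ι] [Finite ι']

open Classical in
/-- The program of the combined machine. -/
noncomputable def program : D.State → Instr ι' κ D.Stack D.State
  | .main (.inl q) => match D.outer.instr q with
    | .push k b q' => .push (.inl k) b (.main (.inl q'))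
    | .pop k next => .pop (.inl k) fun o => .main (.inl (next o))
    | .branch next => .branch fun c => .main (.inl (next (D.outerChoice c)))
    | .query S _ => .branch fun _ => .main (.inr (q, S, fun _ => false))
    | .halt b => .halt (D.outcome b)
  | .main (.inr (q, R, a)) =>
      -- The queries of one step are taken up in increasing order. This is what makes `xorMachine`
      -- query oracle `0` before oracle `1`.
      if h : R.Nonempty then .branch fun _ => .unload (q, R, a) (R.min' h)
      else match D.outer.instr q with
        | .query S next => .branch fun _ => .clear (D.querySet S) (.inl (next a))
        | _ => .halt false
  | .clear T r =>
      if h : T.Nonempty then .pop h.choose fun o =>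
        o.elim (.clear (T.erase h.choose) r) fun _ => .clear T r
      else .branch fun _ => .main r
  | .unload x i => .pop (.inl (D.outer.qry i)) fun o => o.elim (.load x i) (.unloadPush x i)
  | .unloadPush x i b => .push (.inr (.inr ())) b (.unload x i)
  | .load x i => .pop (.inr (.inr ())) fun o =>
      o.elim (.work x i (D.inner i).start) (.loadPush x i)
  | .loadPush x i b => .push (.inl (D.outer.qry i)) b (.loadPush' x i b)
  | .loadPush' x i b => .push (.inr (.inl (D.embed i (D.inner i).inp))) b (.load x i)
  | .work x i q => match (D.inner i).instr q with
    | .push k b q' => .push (.inr (.inl (D.embed i k))) b (.work x i q')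
    | .pop k next => .pop (.inr (.inl (D.embed i k))) fun o => .work x i (next o)
    | .branch next => .branch fun c => .work x i (next (D.innerChoice i c))
    | .query S next =>
        -- A query step about no oracle becomes a plain step. Otherwise it would put `∅` into the
        -- log, which the restrictions of `POrdered` and `POnePoly` forbid.
        if S.Nonempty then
          .query (S.image (D.oracle i)) fun a => .work x i (next fun j => a (D.oracle i j))
        else .branch fun _ => .work x i (next fun _ => false)
    | .halt b => match D.answer i b with
      | none => .halt false
      | some v => .branch fun _ =>
          .clear D.innerSet (.inr (x.1, x.2.1.erase i, Function.update x.2.2 i v))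

/-- The machine that answers the queries of `outer` by running the inner machines. -/
@[reducible] noncomputable def machine : OTM ι' κ where
  Q := D.State
  K := D.Stack
  decK := Classical.decEq _
  start := .main (.inl D.outer.start)
  inp := .inl D.outer.inp
  qry o := .inr (.inl (.inl o))
  instr := D.program

/-- The contents of the stacks of the combined machine. -/
def contents (o : D.outer.K → List Bool) (w : D.InnerStack → List Bool) (t : List Bool) :
    D.Stack → List Bool :=
  Sum.elim o (Sum.elim w fun _ => t)

end Substitution

-- While `inner i` works, its stacks appear in the combined machine as `extend (embed i) s` with
-- empty words elsewhere. Writing on a stack commutes with this embedding.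
open Function in
theorem update_extend_apply {α β γ : Type} [DecidableEq α] [DecidableEq β] {e : α → β}
    (he : e.Injective) (s : α → γ) (d : β → γ) (a : α) (v : γ) :
    update (extend e s d) (e a) v = extend e (update s a v) d := by
  funext b
  by_cases hb : ∃ a', e a' = b
  · obtain ⟨a', rfl⟩ := hb
    rw [he.extend_apply]
    by_cases haa : a' = a
    · subst haa
      simp
    · rw [update_of_ne (fun h => haa (he h)), update_of_ne haa, he.extend_apply]
  · rw [extend_apply' _ _ _ hb, update_of_ne, extend_apply' _ _ _ hb]
    rintro rfl
    exact hb ⟨a, rfl⟩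

/-! ### Time and outcome of the combined machine, phase by phase. -/

namespace Substitution

variable {ι ι₁ ι' κ₁ κ : Type} {κ₂ : ι → Type} {D : Substitution ι ι₁ ι' κ₁ κ κ₂}

theorem update_contents_outer [DecidableEq D.Stack] (o : D.outer.K → List Bool)
    (w : D.InnerStack → List Bool) (t : List Bool) (k : D.outer.K) (v : List Bool) :
    Function.update (D.contents o w t) (.inl k) v = D.contents (Function.update o k v) w t := by
  simp only [contents, Sum.update_elim_inl]

theorem update_contents_inner [DecidableEq D.Stack] [DecidableEq D.InnerStack]
    (o : D.outer.K → List Bool) (w : D.InnerStack → List Bool) (t : List Bool)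
    (k : D.InnerStack) (v : List Bool) :
    Function.update (D.contents o w t) (.inr (.inl k)) v =
      D.contents o (Function.update w k v) t := by
  classical
  simp only [contents, Sum.update_elim_inr, Sum.update_elim_inl]

theorem update_contents_copy [DecidableEq D.Stack]
    (o : D.outer.K → List Bool) (w : D.InnerStack → List Bool) (t : List Bool) (v : List Bool) :
    Function.update (D.contents o w t) (.inr (.inr ())) v = D.contents o w v := by
  classical
  simp only [contents, Sum.update_elim_inr]
  congr 2

variable [LinearOrder ι] [Finite ι] [Finite ι']

section Step

variable {O : ι' → Lang} {c : κ} {q q' : D.State} {stk : D.Stack → List Bool}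
  {log : List (Finset ι')}

theorem step_push [inst : DecidableEq D.Stack] {k : D.Stack} {b : Bool}
    (hq : D.program q = .push k b q') :
    D.machine.step O c ⟨q, stk, log⟩ = ⟨q', @Function.update D.Stack (fun _ => List Bool) inst stk k (b :: stk k), log⟩ := by
  obtain rfl : inst = Classical.decEq _ := Subsingleton.elim _ _
  simp only [OTM.step, hq]

theorem step_pop [inst : DecidableEq D.Stack] {k : D.Stack} {next : Option Bool → D.State}
    (hq : D.program q = .pop k next) :
    D.machine.step O c ⟨q, stk, log⟩ =
      ⟨next (stk k).head?,
        @Function.update D.Stack (fun _ => List Bool) inst stk k (stk k).tail, log⟩ := by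
  obtain rfl : inst = Classical.decEq _ := Subsingleton.elim _ _
  simp only [OTM.step, hq]

theorem step_branch {next : κ → D.State} (hq : D.program q = .branch next) :
    D.machine.step O c ⟨q, stk, log⟩ = ⟨next c, stk, log⟩ := by
  simp only [OTM.step, hq]

open Classical in
theorem step_query {S : Finset ι'} {next : (ι' → Bool) → D.State}
    (hq : D.program q = .query S next) :
    D.machine.step O c ⟨q, stk, log⟩ =
      ⟨next fun i => decide (i ∈ S ∧ stk (.inr (.inl (.inl i))) ∈ O i),
        fun k => if ∃ i ∈ S, (.inr (.inl (.inl i)) : D.Stack) = k then [] else stk k,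
        log ++ [S]⟩ := by
  simp only [OTM.step, hq]

end Step

/-- The configurations of the combined machine with the given state and stacks are evaluated within
`n` steps. -/
def Decides (D : Substitution ι ι₁ ι' κ₁ κ κ₂) (O : ι' → Lang) (n : ℕ) (q : D.State)
    (stk : D.Stack → List Bool) (φ : Prop) : Prop :=
  ∀ log, D.machine.Evaluates O (fun _ => Set.univ) (fun _ => True) (· = true) n ⟨q, stk, log⟩ φ

namespace Decides

variable {O : ι' → Lang} {n m : ℕ} {q q' : D.State} {stk : D.Stack → List Bool} {φ : Prop}

theorem mono (h : D.Decides O n q stk φ) (hnm : n ≤ m) : D.Decides O m q stk φ :=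
  fun log => (h log).mono hnm

theorem halt {b : Bool} (hq : D.program q = .halt b) (hφ : φ ↔ b = true) :
    D.Decides O n q stk φ := by
  intro log
  rw [hφ]
  exact .halt (ψ := (· = true)) (b := b) hq trivial

variable [Nonempty κ]

theorem goto (hq : D.program q = .branch fun _ => q') (h : D.Decides O n q' stk φ) :
    D.Decides O (n + 1) q stk φ := by
  intro log
  refine .deterministic (s' := ⟨q', stk, log⟩) ?_ ?_ (h log)
  · intro b hb
    cases hq.symm.trans hb
  · exact fun c => step_branch hq

open Classical in
theorem push {k : D.Stack} {b : Bool} (hq : D.program q = .push k b q')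
    (h : D.Decides O n q' (Function.update stk k (b :: stk k)) φ) :
    D.Decides O (n + 1) q stk φ := by
  intro log
  refine .deterministic ?_ ?_ (h log)
  · intro b hb
    cases hq.symm.trans hb
  · exact fun c => step_push hq

open Classical in
theorem pop {k : D.Stack} {next : Option Bool → D.State} (hq : D.program q = .pop k next)
    (h : D.Decides O n (next (stk k).head?) (Function.update stk k (stk k).tail) φ) :
    D.Decides O (n + 1) q stk φ := by
  intro log
  refine .deterministic ?_ ?_ (h log)
  · intro b hb
    cases hq.symm.trans hb
  · exact fun c => step_pop hq

open Classical in
theorem clear {T : Finset D.Stack} {r : D.outer.Q ⊕ D.Task} {B : ℕ}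
    (hB : ∀ k ∈ T, (stk k).length ≤ B)
    (h : D.Decides O n (.main r) (fun k => if k ∈ T then [] else stk k) φ) :
    D.Decides O (n + T.card * (B + 1) + 1) (.clear T r) stk φ := by
  -- The sum counts the pops: one for each symbol, and one on each stack that finds it empty and
  -- removes it from `T`.
  have key : ∀ m (T : Finset D.Stack) (stk : D.Stack → List Bool),
      ∑ k ∈ T, ((stk k).length + 1) = m →
      D.Decides O n (.main r) (fun k => if k ∈ T then [] else stk k) φ →
      D.Decides O (n + m + 1) (.clear T r) stk φ := by
    intro m
    induction m with
    | zero =>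
      intro T stk hm h
      have hT : T = ∅ := by
        rw [Finset.sum_eq_zero_iff] at hm
        exact Finset.eq_empty_of_forall_notMem fun k hk => by simpa using hm k hk
      subst hT
      refine goto (q' := .main r) ?_ (by simpa using h)
      simp [program]
    | succ m ih =>
      intro T stk hm h
      have hT : T.Nonempty := by
        rw [Finset.nonempty_iff_ne_empty]
        rintro rfl
        simp at hm
      have hk := hT.choose_spec
      refine pop (k := hT.choose) (next := fun o => o.elim (.clear (T.erase hT.choose) r)
        fun _ => .clear T r) (by rw [program, dif_pos hT]) ?_
      generalize hT.choose = k at hk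
      rw [← Finset.add_sum_erase _ _ hk] at hm
      rcases hl : stk k with _ | ⟨b, l⟩
      · have hu : Function.update stk k [] = stk := by rw [← hl, Function.update_eq_self]
        simp only [List.head?_nil, List.tail_nil, hu]
        refine (ih _ _ ?_ ?_)
        · simp only [hl, List.length_nil] at hm
          omega
        · convert h using 2 with k'
          by_cases hkk : k' = k
          · subst hkk
            simp [hl]
          · simp [hkk]
      · simp only [List.head?_cons, List.tail_cons]
        refine (ih _ _ ?_ ?_)
        · rw [← Finset.add_sum_erase _ _ hk]
          simp only [hl, List.length_cons, Function.update_self] at hm ⊢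
          rw [Finset.sum_congr rfl fun k' hk' => by
            rw [Function.update_of_ne (Finset.ne_of_mem_erase hk')]]
          omega
        · convert h using 2 with k'
          by_cases hkk : k' = k
          · subst hkk
            simp [hk]
          · simp [hkk]
  refine (key _ T stk rfl h).mono ?_
  have : ∑ k ∈ T, ((stk k).length + 1) ≤ T.card * (B + 1) := by
    rw [← smul_eq_mul]
    exact Finset.sum_le_card_nsmul _ _ _ fun k hk => by have := hB k hk; omega
  omega

open Classical in
theorem unload {x : D.Task} {i : ι} {o : D.outer.K → List Bool} {w : D.InnerStack → List Bool}
    {t l : List Bool} (hl : o (D.outer.qry i) = l)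
    (h : D.Decides O n (.load x i)
      (D.contents (Function.update o (D.outer.qry i) []) w (l.reverse ++ t)) φ) :
    D.Decides O (n + 2 * l.length + 1) (.unload x i) (D.contents o w t) φ := by
  induction l generalizing o t with
  | nil =>
    refine pop (by rw [program]) ?_
    rw [update_contents_outer]
    have : D.contents o w t (.inl (D.outer.qry i)) = [] := hl
    rw [this]
    simpa using h
  | cons b l ih =>
    have ho : D.contents o w t (.inl (D.outer.qry i)) = b :: l := hl
    have := ih (o := Function.update o (D.outer.qry i) l) (t := b :: t) (by simp)
      (by simpa using h)
    refine (pop (by rw [program]) (n := n + 2 * l.length + 1 + 1) ?_).mono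
      (by simp only [List.length_cons]; omega)
    rw [ho, update_contents_outer]
    simp only [List.head?_cons, List.tail_cons, Option.elim_some]
    refine push (by rw [program]) ?_
    rw [update_contents_copy]
    exact this

-- Unloading reverses the query and loading reverses it back. The word is also restored on the query
-- stack of `outer`, because several oracles of `outer` may share that stack and still need it.
open Classical in
theorem load [Subsingleton ι₁] {x : D.Task} {i : ι} {o : D.outer.K → List Bool}
    {s : (D.inner i).K → List Bool} {t : List Bool}
    (h : D.Decides O n (.work x i (D.inner i).start)
      (D.contents (Function.update o (D.outer.qry i) (t.reverse ++ o (D.outer.qry i)))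
        (Function.extend (D.embed i) (Function.update s (D.inner i).inp
          (t.reverse ++ s (D.inner i).inp)) fun _ => []) []) φ) :
    D.Decides O (n + 3 * t.length + 1) (.load x i)
      (D.contents o (Function.extend (D.embed i) s fun _ => []) t) φ := by
  induction t generalizing o s with
  | nil =>
    refine pop (by rw [program]) ?_
    rw [update_contents_copy]
    simpa [contents] using h
  | cons b t ih =>
    have := ih (o := Function.update o (D.outer.qry i) (b :: o (D.outer.qry i)))
      (s := Function.update s (D.inner i).inp (b :: s (D.inner i).inp))
      (by simpa using h)
    refine (pop (by rw [program]) (n := n + 3 * t.length + 1 + 1 + 1) ?_).mono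
      (by simp only [List.length_cons]; omega)
    rw [update_contents_copy]
    change D.Decides O _ (.loadPush x i b) _ φ
    refine push (by rw [program]) ?_
    rw [update_contents_outer]
    refine push (by rw [program]) ?_
    rw [update_contents_inner]
    rw [← update_extend_apply (D.embed_injective i)] at this
    simpa only [contents, Sum.elim_inr, Sum.elim_inl, (D.embed_injective i).extend_apply,
      List.tail_cons] using this

end Decides

theorem step_work [Subsingleton ι₁] {O : ι' → Lang} {x : D.Task} {i : ι} {s : (D.inner i).Cfg}
    (hs : ∀ b, (D.inner i).instr s.state ≠ .halt b) (c : κ) (o : D.outer.K → List Bool)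
    (t : List Bool) (log : List (Finset ι')) :
    ∃ log', D.machine.step O c ⟨.work x i s.state,
      D.contents o (Function.extend (D.embed i) s.stk fun _ => []) t, log⟩ =
      ⟨.work x i ((D.inner i).step (fun j => O (D.oracle i j)) (D.innerChoice i c) s).state,
        D.contents o (Function.extend (D.embed i)
          ((D.inner i).step (fun j => O (D.oracle i j)) (D.innerChoice i c) s).stk
          fun _ => []) t, log'⟩ := by
  classical
  have he := D.embed_injective i
  obtain ⟨q, stk, l⟩ := s
  dsimp only at hs ⊢
  rcases hq : (D.inner i).instr q with ⟨k, b, q'⟩ | ⟨k, next⟩ | next | ⟨S, next⟩ | b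
  · refine ⟨log, ?_⟩
    rw [step_push (by simp only [program, hq]; rfl), update_contents_inner]
    simp only [OTM.step, hq]
    rw [← update_extend_apply he]
    simp only [contents, Sum.elim_inr, Sum.elim_inl, he.extend_apply]
  · refine ⟨log, ?_⟩
    rw [step_pop (by simp only [program, hq]; rfl), update_contents_inner]
    simp only [OTM.step, hq]
    rw [← update_extend_apply he]
    simp only [contents, Sum.elim_inr, Sum.elim_inl, he.extend_apply]
  · refine ⟨log, ?_⟩
    rw [step_branch (by simp only [program, hq]; rfl)]
    simp only [OTM.step, hq]
  · by_cases hS : S.Nonempty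
    · refine ⟨log ++ [S.image (D.oracle i)], ?_⟩
      rw [step_query (by simp only [program, hq, if_pos hS]; rfl)]
      simp only [OTM.step, hq]
      have hmem : ∀ j, D.oracle i j ∈ S.image (D.oracle i) ↔ j ∈ S := by
        intro j
        refine ⟨fun h => ?_, fun h => Finset.mem_image_of_mem _ h⟩
        obtain ⟨j', hj', -⟩ := Finset.mem_image.1 h
        rwa [Subsingleton.elim j j']
      congr 1
      · congr 2
        funext j
        simp only [hmem, contents, Sum.elim_inr, Sum.elim_inl, ← D.embed_qry, he.extend_apply]
        congr
      · funext k
        rcases k with k | k | k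
        · simp [contents]
        · simp only [contents, Sum.elim_inr, Sum.elim_inl]
          by_cases hk : ∃ k', D.embed i k' = k
          · obtain ⟨k', rfl⟩ := hk
            rw [he.extend_apply, he.extend_apply]
            have : (∃ o ∈ S.image (D.oracle i),
                (Sum.inr (Sum.inl (Sum.inl o)) : D.Stack) = .inr (.inl (D.embed i k'))) ↔
                ∃ j ∈ S, (D.inner i).qry j = k' := by
              simp only [Finset.exists_mem_image, ← D.embed_qry, Sum.inr.injEq, Sum.inl.injEq,
                he.eq_iff]
            simp only [this]
          · rw [Function.extend_apply' _ _ _ hk, Function.extend_apply' _ _ _ hk, ite_self]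
        · simp [contents]
    · rw [Finset.not_nonempty_iff_eq_empty] at hS
      subst hS
      refine ⟨log, ?_⟩
      rw [step_branch (by simp only [program, hq, Finset.not_nonempty_empty, if_false]; rfl)]
      simp [OTM.step, hq]
  · exact absurd hq (hs b)

end Substitution

theorem OTM.length_step_le {ι κ : Type} {M : OTM ι κ} (A : ι → Lang) (c : κ) (s : M.Cfg) (k : M.K) :
    ((M.step A c s).stk k).length ≤ (s.stk k).length + 1 := by
  rcases hq : M.instr s.state with ⟨k', b, q'⟩ | ⟨k', next⟩ | next | ⟨S, next⟩ | b <;>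
    simp only [OTM.step, hq]
  · by_cases hk : k = k'
    · subst hk
      simp
    · rw [Function.update_of_ne hk]
      omega
  · by_cases hk : k = k'
    · subst hk
      simp only [Function.update_self, List.length_tail]
      omega
    · rw [Function.update_of_ne hk]
      omega
  · omega
  · split_ifs
    · simp
    · omega
  · omega

namespace Substitution

variable {ι ι₁ ι' κ₁ κ : Type} {κ₂ : ι → Type} {D : Substitution ι ι₁ ι' κ₁ κ κ₂}

theorem extend_embed_nil (i : ι) :
    Function.extend (D.embed i) (fun _ => ([] : List Bool)) (fun _ => []) = fun _ => [] := by
  classical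
  funext k
  rw [Function.extend]
  split_ifs <;> rfl

/-- A bound for the time taken by one query, where the inner machine takes time `m`. -/
noncomputable def answerTime (D : Substitution ι ι₁ ι' κ₁ κ κ₂) (L m : ℕ) : ℕ :=
  5 * L + m + Nat.card D.Stack * (L + m + 1) + 5

/-- A bound for the time taken to simulate one step of the outer machine. -/
noncomputable def stepTime (D : Substitution ι ι₁ ι' κ₁ κ κ₂) (L m : ℕ) : ℕ :=
  Nat.card ι * D.answerTime L m + Nat.card D.Stack * (L + 1) + 3

theorem mem_querySet {S : Finset ι} {k : D.Stack} :
    k ∈ D.querySet S ↔ ∃ i ∈ S, .inl (D.outer.qry i) = k := by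
  simp [querySet]

variable [Finite ι] [Finite ι']

theorem mem_innerSet {k : D.Stack} : k ∈ D.innerSet ↔ ∃ k', k = .inr (.inl k') := by
  simp [innerSet, eq_comm]

theorem card_le_card_stack (T : Finset D.Stack) : T.card ≤ Nat.card D.Stack := by
  have := Fintype.ofFinite D.Stack
  rw [Nat.card_eq_fintype_card]
  exact Finset.card_le_univ T

variable [LinearOrder ι]

namespace Decides

variable {O : ι' → Lang} {n m : ℕ} {Φ : Prop} {o : D.outer.K → List Bool}

variable [Subsingleton ι₁] [Nonempty κ]

/-- All branches that answer give the same answer `a`, and the others reject. The continuation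
therefore does not depend on the branch, and acceptance splits into "some branch answers" (`φ`) and
"the continuation accepts" (`Φ`). -/
theorem work (hg : ∀ i, Function.Surjective (D.innerChoice i)) {x : D.Task} {i : ι} {a : Bool}
    {s : (D.inner i).Cfg} {φ : Prop} {B : ℕ}
    (h : (D.inner i).Evaluates (fun j => O (D.oracle i j)) (fun _ => Set.univ)
      (fun b => ∀ a', D.answer i b = some a' → a' = a) (fun b => ∃ a', D.answer i b = some a')
      m s φ)
    (hB : ∀ k, (s.stk k).length + m ≤ B)
    (hafter : ∀ w : (D.inner i).K → List Bool, (∀ k, (w k).length ≤ B) →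
      D.Decides O n (.clear D.innerSet (.inr (x.1, x.2.1.erase i, Function.update x.2.2 i a)))
        (D.contents o (Function.extend (D.embed i) w fun _ => []) []) Φ) :
    D.Decides O (n + m + 1) (.work x i s.state)
      (D.contents o (Function.extend (D.embed i) s.stk fun _ => []) []) (φ ∧ Φ) := by
  induction h with
  | halt hb hsafe =>
    rename_i m s b
    rcases ha : D.answer i b with _ | a'
    · refine halt (b := false) ?_ (by simp)
      simp only [program, hb, ha]
    · obtain rfl := hsafe a' ha
      simp only [Option.some.injEq, exists_eq', true_and]
      refine mono (goto ?_ (hafter s.stk fun k => (hB k).trans' (by omega)))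
        (show n + 1 ≤ n + m + 1 by omega)
      simp only [program, hb, ha]
  | step hs hsub ih =>
    rename_i m s φ
    intro log
    have hs' : ∀ b, D.machine.instr (.work x i s.state) ≠ .halt b := by
      intro b hb
      simp only [program] at hb
      rcases hq : (D.inner i).instr s.state with ⟨k, b', q'⟩ | ⟨k, next⟩ | next | ⟨S, next⟩ | b'
      · simp [hq] at hb
      · simp [hq] at hb
      · simp [hq] at hb
      · simp only [hq] at hb
        split_ifs at hb
      · exact hs _ hq
    have := OTM.Evaluates.step (M := D.machine) (A := O) (V := fun _ => Set.univ)
      (safe := fun _ => True) (ψ := (· = true)) (n := n + m + 1)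
      (s := ⟨.work x i s.state,
        D.contents o (Function.extend (D.embed i) s.stk fun _ => []) [], log⟩)
      (φ := fun c => φ (D.innerChoice i c) ∧ Φ) hs' (by
        intro c
        obtain ⟨log', hlog'⟩ := step_work (O := O) (x := x) hs c o [] log
        rw [hlog']
        refine ih _ (fun k => ?_) log'
        have h1 := OTM.length_step_le (fun j => O (D.oracle i j)) (D.innerChoice i c) s k
        have h2 := hB k
        omega)
    convert this using 1
    · omega
    simp only [OTM.verified_univ, true_and, exists_and_right,
      (hg i).exists (p := fun c => φ c)]

theorem answer (hg : ∀ i, Function.Surjective (D.innerChoice i)) {q : D.outer.Q} {R : Finset ι}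
    {a : ι → Bool} {v : Bool} {φ : Prop} {L : ℕ} (hR : R.Nonempty)
    (hL : (o (D.outer.qry (R.min' hR))).length ≤ L)
    (hi : (D.inner (R.min' hR)).Evaluates (fun j => O (D.oracle (R.min' hR) j))
      (fun _ => Set.univ) (fun b => ∀ a', D.answer (R.min' hR) b = some a' → a' = v)
      (fun b => ∃ a', D.answer (R.min' hR) b = some a') m
      ((D.inner (R.min' hR)).initCfg (o (D.outer.qry (R.min' hR)))) φ)
    (h : D.Decides O n
      (.main (.inr (q, R.erase (R.min' hR), Function.update a (R.min' hR) v)))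
      (D.contents o (fun _ => []) []) Φ) :
    D.Decides O (n + D.answerTime L m) (.main (.inr (q, R, a)))
      (D.contents o (fun _ => []) []) (φ ∧ Φ) := by
  classical
  generalize hRi : R.min' hR = i at *
  have hwork := work (n := n + D.innerSet.card * (L + m + 1) + 1) (o := o) (Φ := Φ)
    (x := (q, R, a)) (B := L + m) hg hi
    (by
      intro k
      simp only [OTM.initCfg]
      by_cases hk : k = (D.inner i).inp
      · subst hk
        simpa using hL
      · rw [Function.update_of_ne hk]
        simp)
    (by
      intro w hw
      refine clear ?_ ?_
      · intro k hk
        obtain ⟨k', rfl⟩ := mem_innerSet.1 hk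
        simp only [contents, Sum.elim_inr, Sum.elim_inl]
        rw [Function.extend]
        split_ifs
        · exact hw _
        · simp
      · convert h using 2 with k
        rcases k with k | k | k <;> simp [contents, mem_innerSet])
  have hload := load (t := (o (D.outer.qry i)).reverse) (s := fun _ => [])
    (o := Function.update o (D.outer.qry i) []) (D := D) (i := i) (x := (q, R, a)) (O := O)
    (φ := φ ∧ Φ) (by simpa [OTM.initCfg] using hwork)
  rw [extend_embed_nil] at hload
  have hunload := unload (x := (q, R, a)) (i := i) (w := fun _ => []) (t := []) (o := o) rfl
    (by simpa using hload)
  have hgoto := goto (q := .main (.inr (q, R, a))) (by rw [program, dif_pos hR, hRi]) hunload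
  refine hgoto.mono ?_
  have := Nat.mul_le_mul_right (L + m + 1) (card_le_card_stack (D := D) D.innerSet)
  simp only [answerTime]
  omega

-- Induction on the number of unanswered queries. Each contributes its condition of being answered;
-- once `R` is empty, `a` is exactly the answer function of the query step of `outer`, whose query
-- stacks are then emptied.
open Classical in
theorem answers (hg : ∀ i, Function.Surjective (D.innerChoice i)) {𝒜 V : ι → Lang} {q : D.outer.Q}
    {S : Finset ι} {next : (ι → Bool) → D.outer.Q} (hq : D.outer.instr q = .query S next) {L : ℕ}
    (hL : ∀ k, (o k).length ≤ L)
    (hi : ∀ i (l : List Bool), l.length ≤ L →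
      (D.inner i).Evaluates (fun j => O (D.oracle i j))
        (fun _ => Set.univ) (fun b => ∀ a', D.answer i b = some a' → a' = decide (l ∈ 𝒜 i))
        (fun b => ∃ a', D.answer i b = some a') m ((D.inner i).initCfg l) (l ∈ V i))
    (h : D.Decides O n
      (.main (.inl (next fun i => decide (i ∈ S ∧ o (D.outer.qry i) ∈ 𝒜 i))))
      (D.contents (fun k => if ∃ i ∈ S, D.outer.qry i = k then [] else o k) (fun _ => []) []) Φ)
    (R : Finset ι) (a : ι → Bool) (hRS : R ⊆ S)
    (ha : ∀ i ∉ R, a i = decide (i ∈ S ∧ o (D.outer.qry i) ∈ 𝒜 i)) :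
    D.Decides O (n + R.card * D.answerTime L m + Nat.card D.Stack * (L + 1) + 2)
      (.main (.inr (q, R, a))) (D.contents o (fun _ => []) [])
      ((∀ i ∈ R, o (D.outer.qry i) ∈ V i) ∧ Φ) := by
  induction hc : R.card generalizing R a with
  | zero =>
    rw [Finset.card_eq_zero] at hc
    subst hc
    obtain rfl : a = _ := funext fun i => ha i (by simp)
    simp only [Finset.notMem_empty, false_imp_iff, implies_true, true_and, zero_mul, add_zero]
    have hclear := clear (T := D.querySet S)
      (r := .inl (next fun i => decide (i ∈ S ∧ o (D.outer.qry i) ∈ 𝒜 i))) (B := L) (O := O)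
      (stk := D.contents o (fun _ => []) []) (φ := Φ) (n := n)
      (by
        rintro k hk
        obtain ⟨i, -, rfl⟩ := mem_querySet.1 hk
        exact hL _)
      (by
        convert h using 2 with k
        rcases k with k | k | k <;> simp [contents, mem_querySet])
    refine (goto ?_ hclear).mono ?_
    · rw [program, dif_neg Finset.not_nonempty_empty]
      simp only [hq]
    · have := Nat.mul_le_mul_right (L + 1) (card_le_card_stack (D := D) (D.querySet S))
      omega
  | succ r ih =>
    have hR : R.Nonempty := Finset.card_pos.1 (by omega)
    have hmin := R.min'_mem hR
    have hrest := ih (R.erase (R.min' hR))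
      (Function.update a (R.min' hR) (decide (o (D.outer.qry (R.min' hR)) ∈ 𝒜 (R.min' hR))))
      ((R.erase_subset _).trans hRS)
      (by
        intro i hiR
        by_cases hi' : i = R.min' hR
        · rw [hi', Function.update_self]
          simp [hRS hmin]
        · rw [Function.update_of_ne hi']
          exact ha i fun h => hiR (Finset.mem_erase.2 ⟨hi', h⟩))
      (by rw [Finset.card_erase_of_mem hmin]; omega)
    have := (answer hg hR (hL _) (hi _ _ (hL _)) hrest).mono
      (show _ ≤ n + (r + 1) * D.answerTime L m + Nat.card D.Stack * (L + 1) + 2 by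
        rw [add_mul]; omega)
    convert this using 1
    rw [← and_assoc]
    refine and_congr_left fun _ => ?_
    constructor
    · exact fun h => ⟨h _ hmin, fun i hi => h i (Finset.mem_of_mem_erase hi)⟩
    · rintro ⟨h1, h2⟩ i hi
      by_cases hi' : i = R.min' hR
      · rw [hi']
        exact h1
      · exact h2 i (Finset.mem_erase.2 ⟨hi', hi⟩)

end Decides

theorem step_main {O : ι' → Lang} {𝒜 : ι → Lang} {s : D.outer.Cfg}
    (hs : ∀ b, D.outer.instr s.state ≠ .halt b)
    (hs' : ∀ S next, D.outer.instr s.state ≠ .query S next) (c : κ)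
    (log : List (Finset ι')) :
    ∃ log', D.machine.step O c ⟨.main (.inl s.state), D.contents s.stk (fun _ => []) [], log⟩ =
      ⟨.main (.inl (D.outer.step 𝒜 (D.outerChoice c) s).state),
        D.contents (D.outer.step 𝒜 (D.outerChoice c) s).stk (fun _ => []) [], log'⟩ := by
  classical
  refine ⟨log, ?_⟩
  obtain ⟨q, stk, l⟩ := s
  dsimp only at hs hs' ⊢
  rcases hq : D.outer.instr q with ⟨k, b, q'⟩ | ⟨k, next⟩ | next | ⟨S, next⟩ | b
  · rw [step_push (by simp only [program, hq]; rfl), update_contents_outer]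
    simp only [OTM.step, hq, contents, Sum.elim_inl]
  · rw [step_pop (by simp only [program, hq]; rfl), update_contents_outer]
    simp only [OTM.step, hq, contents, Sum.elim_inl]
  · rw [step_branch (by simp only [program, hq]; rfl)]
    simp only [OTM.step, hq]
  · exact absurd hq (hs' _ _)
  · exact absurd hq (hs b)

/-- A step lengthens a stack by at most one symbol, so length plus remaining time never grows. Hence
`L` bounds every word that is queried. Surjectivity of the choice maps ensures that every branch of
the simulated machines occurs. -/
theorem decides_main [Subsingleton ι₁] [Nonempty κ] (hf : Function.Surjective D.outerChoice)
    (hg : ∀ i, Function.Surjective (D.innerChoice i)) {O : ι' → Lang} {𝒜 V : ι → Lang}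
    {safe : Bool → Prop} {n m L : ℕ} {s : D.outer.Cfg} {φ : Prop}
    (h : D.outer.Evaluates 𝒜 V safe (fun b => D.outcome b = true) n s φ)
    (hL : ∀ k, (s.stk k).length + n ≤ L)
    (hi : ∀ i (l : List Bool), l.length ≤ L →
      (D.inner i).Evaluates (fun j => O (D.oracle i j))
        (fun _ => Set.univ) (fun b => ∀ a', D.answer i b = some a' → (a' = true ↔ l ∈ 𝒜 i))
        (fun b => ∃ a', D.answer i b = some a') m ((D.inner i).initCfg l) (l ∈ V i)) :
    D.Decides O (n * D.stepTime L m) (.main (.inl s.state)) (D.contents s.stk (fun _ => []) [])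
      φ := by
  classical
  induction h with
  | halt hb hsafe =>
    refine Decides.halt (b := D.outcome _) ?_ Iff.rfl
    simp only [program, hb]
  | step hs hsub ih =>
    rename_i n s φ
    intro log
    have hs' : ∀ b, D.machine.instr (.main (.inl s.state)) ≠ .halt b := by
      intro b hb
      simp only [program] at hb
      rcases hq : D.outer.instr s.state with ⟨k, b', q'⟩ | ⟨k, next⟩ | next | ⟨S, next⟩ | b'
      · simp [hq] at hb
      · simp [hq] at hb
      · simp [hq] at hb
      · simp [hq] at hb
      · exact hs _ hq
    have hbound : ∀ c k, ((D.outer.step 𝒜 c s).stk k).length + n ≤ L := by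
      intro c k
      have h1 := OTM.length_step_le 𝒜 c s k
      have h2 := hL k
      omega
    by_cases hquery : ∃ S next, D.outer.instr s.state = .query S next
    · obtain ⟨S, next, hq⟩ := hquery
      have key := OTM.Evaluates.step (M := D.machine) (A := O) (V := fun _ => Set.univ)
        (safe := fun _ => True) (ψ := (· = true))
        (n := n * D.stepTime L m + S.card * D.answerTime L m + Nat.card D.Stack * (L + 1) + 2)
        (s := ⟨.main (.inl s.state), D.contents s.stk (fun _ => []) [], log⟩)
        (φ := fun c => (∀ i ∈ S, s.stk (D.outer.qry i) ∈ V i) ∧ φ (D.outerChoice c)) hs' (by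
          intro c
          rw [step_branch (by simp only [program, hq]; rfl)]
          refine Decides.answers (𝒜 := 𝒜) hg hq (fun k => (hL k).trans' (by omega)) ?_ ?_ S _
            subset_rfl ?_ log
          · intro i l hl
            convert hi i l hl using 6
            rw [Bool.eq_iff_iff, decide_eq_true_iff]
          · have := ih (D.outerChoice c) (hbound _)
            simp only [OTM.step, hq] at this
            convert this
          · intro i hiS
            simp [hiS])
      have hcard : S.card ≤ Nat.card ι := by
        have := Fintype.ofFinite ι
        rw [Nat.card_eq_fintype_card]
        exact Finset.card_le_univ S
      have hcard' := Nat.mul_le_mul_right (D.answerTime L m) hcard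
      have key' := key.mono (show _ ≤ (n + 1) * D.stepTime L m by
        rw [add_mul, stepTime]; omega)
      convert key' using 1
      simp only [OTM.verified_univ, true_and, exists_and_left,
        hf.exists (p := fun c => φ c)]
      refine and_congr_left fun _ => ?_
      simp only [OTM.Verified, hq, Instr.query.injEq, and_imp]
      constructor
      · exact fun h => h S next rfl rfl
      · rintro h _ _ rfl rfl
        exact h
    · push Not at hquery
      have key := OTM.Evaluates.step (M := D.machine) (A := O) (V := fun _ => Set.univ)
        (safe := fun _ => True) (ψ := (· = true)) (n := n * D.stepTime L m)
        (s := ⟨.main (.inl s.state), D.contents s.stk (fun _ => []) [], log⟩)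
        (φ := fun c => φ (D.outerChoice c)) hs' (by
          intro c
          obtain ⟨log', hlog'⟩ := step_main (O := O) (𝒜 := 𝒜) hs hquery c log
          rw [hlog']
          exact ih _ (hbound _) log')
      have key' := key.mono (show _ ≤ (n + 1) * D.stepTime L m by
        rw [add_mul, stepTime]; omega)
      convert key' using 1
      have hv : D.outer.Verified V s := fun S next h => absurd h (hquery S next)
      simp only [OTM.verified_univ, hv, true_and, hf.exists (p := fun c => φ c)]

end Substitution

/-! ### The clock and the language of the combined machine. -/

theorem monotone_eval_nat (p : Polynomial ℕ) : Monotone fun n => p.eval n := by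
  intro a b hab
  simp only [Polynomial.eval_eq_sum_range]
  exact Finset.sum_le_sum fun i _ => Nat.mul_le_mul_left _ (Nat.pow_le_pow_left hab i)

namespace OTM

/-- The answers deduced by `answer` from the outcomes of `N` with oracles `A` agree with `B`. -/
def AnswersCorrectly {ι κ : Type} (N : OTM ι κ) (answer : Bool → Option Bool) (A : ι → Lang)
    (B : Lang) : Prop :=
  ∀ x c t b a, N.instr (N.run A c x t).state = .halt b → answer b = some a → (a = true ↔ x ∈ B)

/-- The words for which some computation of `N` with oracles `A` gives an answer. -/
def answered {ι κ : Type} (N : OTM ι κ) (answer : Bool → Option Bool) (A : ι → Lang) : Lang :=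
  N.verifiedLanguage A (fun _ => Set.univ) fun b => ∃ a, answer b = some a

end OTM

namespace Substitution

variable {ι ι₁ ι' κ₁ κ : Type} {κ₂ : ι → Type} {D : Substitution ι ι₁ ι' κ₁ κ κ₂}
  [LinearOrder ι] [Finite ι] [Finite ι'] [Subsingleton ι₁] [Nonempty κ]

theorem machine_evaluates (hf : Function.Surjective D.outerChoice)
    (hg : ∀ i, Function.Surjective (D.innerChoice i)) (hM : D.outer.PolyTime)
    (hN : ∀ i, (D.inner i).PolyTime) :
    ∃ p : Polynomial ℕ, ∀ (O : ι' → Lang) (𝒜 : ι → Lang),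
      (∀ i, (D.inner i).AnswersCorrectly (D.answer i) (fun j => O (D.oracle i j)) (𝒜 i)) →
      ∀ x : List Bool, D.machine.Evaluates O (fun _ => Set.univ) (fun _ => True) (· = true)
        (p.eval x.length) (D.machine.initCfg x)
        (x ∈ D.outer.verifiedLanguage 𝒜
          (fun i => (D.inner i).answered (D.answer i) fun j => O (D.oracle i j))
          fun b => D.outcome b = true) := by
  have := Fintype.ofFinite ι
  have : Nonempty κ₁ := Nonempty.map D.outerChoice inferInstance
  have : ∀ i, Nonempty (κ₂ i) := fun i => Nonempty.map (D.innerChoice i) inferInstance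
  obtain ⟨p, hp⟩ := hM
  choose q hq using hN
  -- `L` bounds the words on the stacks of `outer` (input length plus clock), and `m` bounds the
  -- time of every inner machine on such words. The witness is `p` times `stepTime`, written as a
  -- polynomial.
  let L : Polynomial ℕ := .X + p
  let m : Polynomial ℕ := (∑ i, q i).comp L
  refine ⟨p * (.C (Nat.card ι) * (5 * L + m + .C (Nat.card D.Stack) * (L + m + 1) + 5) +
    .C (Nat.card D.Stack) * (L + 1) + 3), fun O 𝒜 h x => ?_⟩
  have houter := OTM.evaluates_of_halts
    (V := fun i => (D.inner i).answered (D.answer i) fun j => O (D.oracle i j))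
    (safe := fun _ => True) (ψ := fun b => D.outcome b = true) (fun c => hp 𝒜 c x)
    (fun _ _ _ => trivial)
  have hinner : ∀ i (l : List Bool), l.length ≤ L.eval x.length →
      (D.inner i).Evaluates (fun j => O (D.oracle i j))
        (fun _ => Set.univ) (fun b => ∀ a', D.answer i b = some a' → (a' = true ↔ l ∈ 𝒜 i))
        (fun b => ∃ a', D.answer i b = some a') (m.eval x.length) ((D.inner i).initCfg l)
        (l ∈ (D.inner i).answered (D.answer i) fun j => O (D.oracle i j)) := by
    intro i l hl
    refine (OTM.evaluates_of_halts (fun c => hq i _ c l) ?_).mono ?_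
    · exact fun c b hb a ha => h i l c _ b a hb ha
    · refine (monotone_eval_nat (q i) hl).trans ?_
      simp only [m, Polynomial.eval_comp, Polynomial.eval_finsetSum]
      exact Finset.single_le_sum (f := fun i => (q i).eval (L.eval x.length))
        (fun _ _ => Nat.zero_le _) (Finset.mem_univ i)
  have := decides_main hf hg houter (L := L.eval x.length) (m := m.eval x.length)
    (by
      intro k
      simp only [OTM.initCfg, L, Polynomial.eval_add, Polynomial.eval_X]
      by_cases hk : k = D.outer.inp
      · subst hk
        simp
      · rw [Function.update_of_ne hk]
        simp)
    hinner []
  convert this using 1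
  · simp [stepTime, answerTime]
  · have hnil : (fun _ : D.Stack => ([] : List Bool)) =
        D.contents (fun _ => []) (fun _ => []) [] := by
      funext k
      rcases k with k | k | k <;> rfl
    simp only [OTM.initCfg]
    rw [hnil, @update_contents_outer _ _ _ _ _ _ _ (Classical.decEq _)]

/-- The combined machine has a polynomial clock if the answers are always consistent. -/
theorem machine_polyTime (hf : Function.Surjective D.outerChoice)
    (hg : ∀ i, Function.Surjective (D.innerChoice i)) (hM : D.outer.PolyTime)
    (hN : ∀ i, (D.inner i).PolyTime)
    (h : ∀ i (A : ι₁ → Lang), ∃ B, (D.inner i).AnswersCorrectly (D.answer i) A B) :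
    D.machine.PolyTime := by
  obtain ⟨p, hp⟩ := machine_evaluates hf hg hM hN
  refine ⟨p, fun O c x => ?_⟩
  -- The clock must hold for all oracles `O`. Whatever language `B i` the answers of `inner i` agree
  -- with under `O` serves as the oracle of `outer`, whose own clock is independent of it.
  choose B hB using h
  exact (OTM.halts_and_mem_language_iff
    (hp O (fun i => B i _) (fun i => hB i _) x)).1 c

/-- The language of the combined machine. -/
theorem machine_language (hf : Function.Surjective D.outerChoice)
    (hg : ∀ i, Function.Surjective (D.innerChoice i)) (hM : D.outer.PolyTime)
    (hN : ∀ i, (D.inner i).PolyTime) {O : ι' → Lang} {𝒜 : ι → Lang}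
    (h : ∀ i, (D.inner i).AnswersCorrectly (D.answer i) (fun j => O (D.oracle i j)) (𝒜 i)) :
    D.machine.language O = D.outer.verifiedLanguage 𝒜
      (fun i => (D.inner i).answered (D.answer i) fun j => O (D.oracle i j))
      fun b => D.outcome b = true := by
  obtain ⟨p, hp⟩ := machine_evaluates hf hg hM hN
  ext x
  exact (OTM.halts_and_mem_language_iff (hp O 𝒜 h x)).2

end Substitution

/-! ### Elementary machines. -/

namespace OTM

variable {ι κ : Type}

theorem language_iff_of_halts {M : OTM ι κ} {A : ι → Lang} {x : List Bool} {n : ℕ}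
    (hn : ∀ c, ∃ b, M.instr (M.run A c x n).state = .halt b) :
    x ∈ M.language A ↔ ∃ c, M.instr (M.run A c x n).state = .halt true := by
  rw [language_eq_verifiedLanguage, verifiedLanguage_iff_of_halts hn]
  constructor
  · rintro ⟨c, b, h1, rfl, -⟩
    exact ⟨c, h1⟩
  · rintro ⟨c, h⟩
    exact ⟨c, true, h, rfl, fun _ _ => verified_univ _⟩

theorem verified_iff_of_query {M : OTM ι κ} {V : ι → Lang} {s : M.Cfg} {S : Finset ι}
    {next : (ι → Bool) → M.Q} (hs : M.instr s.state = .query S next) :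
    M.Verified V s ↔ ∀ i ∈ S, s.stk (M.qry i) ∈ V i := by
  simp only [Verified, hs, Instr.query.injEq, and_imp]
  constructor
  · exact fun h => h S next rfl rfl
  · rintro h _ _ rfl rfl
    exact h

theorem verified_of_not_query {M : OTM ι κ} {V : ι → Lang} {s : M.Cfg}
    (hs : ∀ S next, M.instr s.state ≠ .query S next) : M.Verified V s :=
  fun S next h => absurd h (hs S next)

theorem AnswersCorrectly.of_deterministic (N : DTM ι) (A : ι → Lang) :
    N.AnswersCorrectly some A (N.language A) := by
  rintro x c t b a hb ⟨⟩
  constructor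
  · rintro rfl
    exact ⟨c, t, hb⟩
  · rintro ⟨c', u, hu⟩
    obtain rfl : c' = c := Subsingleton.elim _ _
    have : N.run A c' x t = N.run A c' x u := by
      rcases le_total t u with h | h
      · exact (run_of_halt h hb).symm
      · exact run_of_halt h hu
    rw [this, hu] at hb
    cases hb
    rfl

theorem answered_some [Nonempty κ] {N : OTM ι κ} (hN : N.PolyTime) (A : ι → Lang) :
    N.answered some A = Set.univ := by
  obtain ⟨p, hp⟩ := hN
  obtain ⟨k⟩ := ‹Nonempty κ›
  ext x
  obtain ⟨b, hb⟩ := hp A (fun _ => k) x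
  simp only [Set.mem_univ, iff_true]
  exact ⟨fun _ => k, _, b, hb, ⟨b, rfl⟩, fun _ _ => verified_univ _⟩

/-- The machine that queries the oracles in `S` about its input, and halts. -/
def ask (κ : Type) (S : Finset ι) (decision : (ι → Bool) → Bool) : OTM ι κ where
  Q := Option Bool
  K := Unit
  start := none
  inp := ()
  qry _ := ()
  instr
    | none => .query S fun a => some (decision a)
    | some b => .halt b

section Ask

variable {S : Finset ι} {decision : (ι → Bool) → Bool}

open Classical in
theorem instr_run_ask (A : ι → Lang) (c : ℕ → κ) (x : List Bool) :
    (ask κ S decision).instr ((ask κ S decision).run A c x 1).state =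
      .halt (decision fun i => decide (i ∈ S ∧ x ∈ A i)) :=
  rfl

theorem polyTime_ask : (ask κ S decision).PolyTime :=
  ⟨1, fun A c x => ⟨_, by rw [Polynomial.eval_one]; exact instr_run_ask A c x⟩⟩

open Classical in
theorem mem_language_ask [Nonempty κ] {A : ι → Lang} {x : List Bool} :
    x ∈ (ask κ S decision).language A ↔
      decision (fun i => decide (i ∈ S ∧ x ∈ A i)) = true := by
  rw [language_iff_of_halts (n := 1) fun c => ⟨_, instr_run_ask A c x⟩]
  simp [instr_run_ask]

open Classical in
theorem mem_verifiedLanguage_ask [Nonempty κ] {A V : ι → Lang} {ψ : Bool → Prop} {x : List Bool} :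
    x ∈ (ask κ S decision).verifiedLanguage A V ψ ↔
      ψ (decision fun i => decide (i ∈ S ∧ x ∈ A i)) ∧ ∀ i ∈ S, x ∈ V i := by
  rw [verifiedLanguage_iff_of_halts (n := 1) fun c => ⟨_, instr_run_ask A c x⟩]
  have h : ∀ c : ℕ → κ, (ask κ S decision).Verified V ((ask κ S decision).run A c x 0) ↔
      ∀ i ∈ S, x ∈ V i := fun c => verified_iff_of_query rfl
  simp [instr_run_ask, h]

end Ask

/-- The oracle that corresponds to a bit. -/
def oracleOfBit (b : Bool) : Fin 2 := if b then 1 else 0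

/-- The machine that pops a bit and then queries the corresponding oracle. -/
def popAsk : DTM (Fin 2) where
  Q := Option (Fin 2 ⊕ Bool)
  K := Unit
  start := none
  inp := ()
  qry _ := ()
  instr
    | none => .pop () fun o => o.elim (some (.inr false)) fun b => some (.inl (oracleOfBit b))
    | some (.inl i) => .query {i} fun a => some (.inr (a i))
    | some (.inr b) => .halt b

/-- The machine that guesses a bit and then queries the corresponding oracle. -/
def guessAsk : NTM (Fin 2) where
  Q := Option (Fin 2 ⊕ Bool)
  K := Unit
  start := none
  inp := ()
  qry _ := ()
  instr
    | none => .branch fun b => some (.inl (oracleOfBit b))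
    | some (.inl i) => .query {i} fun a => some (.inr (a i))
    | some (.inr b) => .halt b

/-- The machine that queries the oracle about its input prefixed by `b`. -/
def tagAsk (b : Bool) : DTM Unit where
  Q := Option (Option Bool)
  K := Unit
  start := none
  inp := ()
  qry _ := ()
  instr
    | none => .push () b (some none)
    | some none => .query {()} fun a => some (some (a ()))
    | some (some b) => .halt b

/-- The disjoint union of two languages. -/
def _root_.QueryOrder.join (A : Fin 2 → Lang) : Lang :=
  {x | ∃ b w, x = b :: w ∧ w ∈ A (oracleOfBit b)}

open Classical in
theorem instr_run_popAsk_nil (A : Fin 2 → Lang) (c : ℕ → Unit) :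
    popAsk.instr (popAsk.run A c [] 2).state = .halt false :=
  rfl

open Classical in
theorem instr_run_popAsk_cons (A : Fin 2 → Lang) (c : ℕ → Unit) (b : Bool) (w : List Bool) :
    popAsk.instr (popAsk.run A c (b :: w) 2).state =
      .halt (decide (w ∈ A (oracleOfBit b))) := by
  -- The run computes definitionally; only the decidability instance inside `step` is left unnamed.
  obtain ⟨inst, h⟩ : ∃ inst, popAsk.instr (popAsk.run A c (b :: w) 2).state =
    .halt (@decide (oracleOfBit b ∈ ({oracleOfBit b} : Finset (Fin 2)) ∧
      w ∈ A (oracleOfBit b)) inst) := ⟨_, rfl⟩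
  rw [h]
  simp

open Classical in
theorem instr_run_guessAsk (A : Fin 2 → Lang) (c : ℕ → Bool) (x : List Bool) :
    guessAsk.instr (guessAsk.run A c x 2).state =
      .halt (decide (x ∈ A (oracleOfBit (c 0)))) := by
  obtain ⟨inst, h⟩ : ∃ inst, guessAsk.instr (guessAsk.run A c x 2).state =
    .halt (@decide (oracleOfBit (c 0) ∈ ({oracleOfBit (c 0)} : Finset (Fin 2)) ∧
      x ∈ A (oracleOfBit (c 0))) inst) := ⟨_, rfl⟩
  rw [h]
  simp

open Classical in
theorem instr_run_tagAsk (A : Unit → Lang) (c : ℕ → Unit) (b : Bool) (x : List Bool) :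
    (tagAsk b).instr ((tagAsk b).run A c x 2).state = .halt (decide (b :: x ∈ A ())) := by
  obtain ⟨inst, h⟩ : ∃ inst, (tagAsk b).instr ((tagAsk b).run A c x 2).state =
    .halt (@decide (() ∈ ({()} : Finset Unit) ∧ b :: x ∈ A ()) inst) := ⟨_, rfl⟩
  rw [h]
  simp

theorem polyTime_popAsk : popAsk.PolyTime := by
  refine ⟨2, fun A c x => ?_⟩
  rw [show Polynomial.eval x.length (2 : Polynomial ℕ) = 2 by simp]
  rcases x with _ | ⟨b, w⟩
  · exact ⟨_, instr_run_popAsk_nil A c⟩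
  · exact ⟨_, instr_run_popAsk_cons A c b w⟩

theorem polyTime_guessAsk : guessAsk.PolyTime := by
  refine ⟨2, fun A c x => ?_⟩
  rw [show Polynomial.eval x.length (2 : Polynomial ℕ) = 2 by simp]
  exact ⟨_, instr_run_guessAsk A c x⟩

theorem polyTime_tagAsk (b : Bool) : (tagAsk b).PolyTime := by
  refine ⟨2, fun A c x => ?_⟩
  rw [show Polynomial.eval x.length (2 : Polynomial ℕ) = 2 by simp]
  exact ⟨_, instr_run_tagAsk A c b x⟩

theorem language_popAsk (A : Fin 2 → Lang) : popAsk.language A = join A := by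
  ext x
  rcases x with _ | ⟨b, w⟩
  · rw [language_iff_of_halts (n := 2) fun c => ⟨_, instr_run_popAsk_nil A c⟩]
    simp [instr_run_popAsk_nil, join]
  · rw [language_iff_of_halts (n := 2) fun c => ⟨_, instr_run_popAsk_cons A c b w⟩]
    cases b <;> simp [instr_run_popAsk_cons, join]

/-- With the oracle `Set.univ` the answer is always "yes", and membership is decided by the
verification alone. This form feeds `verifiedLanguage_mem_sigma_of_join`. -/
theorem verifiedLanguage_popAsk (V : Fin 2 → Lang) :
    popAsk.verifiedLanguage (fun _ => Set.univ) V (· = true) = join V := by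
  ext x
  rcases x with _ | ⟨b, w⟩
  · rw [verifiedLanguage_iff_of_halts (n := 2) fun c => ⟨_, instr_run_popAsk_nil _ c⟩]
    simp [instr_run_popAsk_nil, join]
  · rw [verifiedLanguage_iff_of_halts (n := 2) fun c => ⟨_, instr_run_popAsk_cons _ c b w⟩]
    have h0 : ∀ c, popAsk.Verified V (popAsk.run (fun _ => Set.univ) c (b :: w) 0) :=
      fun c => verified_of_not_query (by rintro S next ⟨⟩)
    have h1 : ∀ c, popAsk.Verified V (popAsk.run (fun _ => Set.univ) c (b :: w) 1) ↔
        ∀ i ∈ ({oracleOfBit b} : Finset (Fin 2)), w ∈ V i := fun c => verified_iff_of_query rfl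
    have h : ∀ c, (∀ u < 2, popAsk.Verified V (popAsk.run (fun _ => Set.univ) c (b :: w) u)) ↔
        w ∈ V (oracleOfBit b) := by
      intro c
      refine ⟨fun h => by simpa using (h1 c).1 (h 1 (by omega)), fun h u hu => ?_⟩
      interval_cases u
      · exact h0 c
      · exact (h1 c).2 (by simpa using h)
    simp only [instr_run_popAsk_cons, h]
    cases b <;> simp [join]

theorem verifiedLanguage_guessAsk (V : Fin 2 → Lang) :
    guessAsk.verifiedLanguage (fun _ => Set.univ) V (· = true) = V 0 ∪ V 1 := by
  ext x
  rw [verifiedLanguage_iff_of_halts (n := 2) fun c => ⟨_, instr_run_guessAsk _ c x⟩]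
  have h0 : ∀ c, guessAsk.Verified V (guessAsk.run (fun _ => Set.univ) c x 0) :=
    fun c => verified_of_not_query (by rintro S next ⟨⟩)
  have h1 : ∀ c, guessAsk.Verified V (guessAsk.run (fun _ => Set.univ) c x 1) ↔
      ∀ i ∈ ({oracleOfBit (c 0)} : Finset (Fin 2)), x ∈ V i := fun c => verified_iff_of_query rfl
  have h : ∀ c, (∀ u < 2, guessAsk.Verified V (guessAsk.run (fun _ => Set.univ) c x u)) ↔
      x ∈ V (oracleOfBit (c 0)) := by
    intro c
    refine ⟨fun h => by simpa using (h1 c).1 (h 1 (by omega)), fun h u hu => ?_⟩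
    interval_cases u
    · exact h0 c
    · exact (h1 c).2 (by simpa using h)
  simp only [instr_run_guessAsk, h]
  have : (∃ c : ℕ → Bool, x ∈ V (oracleOfBit (c 0))) ↔ x ∈ V 0 ∪ V 1 := by
    constructor
    · rintro ⟨c, hc⟩
      cases h : c 0
      · rw [h] at hc
        exact .inl hc
      · rw [h] at hc
        exact .inr hc
    · rintro (h | h)
      · exact ⟨fun _ => false, h⟩
      · exact ⟨fun _ => true, h⟩
  rw [← this]
  simp

theorem language_tagAsk (A : Fin 2 → Lang) (b : Bool) :
    (tagAsk b).language (fun _ => join A) = A (oracleOfBit b) := by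
  ext x
  rw [language_iff_of_halts (n := 2) fun c => ⟨_, instr_run_tagAsk _ c b x⟩]
  cases b <;> simp [instr_run_tagAsk, join]

end OTM

/-! ### Merging oracles, and verification of answers in the hierarchy. -/

open OTM

/-- Queries can be answered by deterministic machines. -/
theorem exists_machine_of_deterministic {ι ι₁ ι' κ : Type} [LinearOrder ι] [Finite ι] [Finite ι']
    [Subsingleton ι₁] [Nonempty κ] {M : OTM ι κ} (hM : M.PolyTime) {N : ι → DTM ι₁}
    (hN : ∀ i, (N i).PolyTime) (h : ι → ι₁ → ι') :
    ∃ C : OTM ι' κ, C.PolyTime ∧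
      ∀ O, C.language O = M.language fun i => (N i).language fun j => O (h i j) := by
  let D : Substitution ι ι₁ ι' κ κ (fun _ => Unit) :=
    { outer := M, inner := N, oracle := h, outerChoice := id, innerChoice := fun _ _ => (),
      answer := fun _ => some, outcome := id }
  have hg : ∀ i, Function.Surjective (D.innerChoice i) :=
    fun i _ => ⟨Classical.arbitrary κ, rfl⟩
  refine ⟨D.machine, D.machine_polyTime Function.surjective_id hg hM hN fun i A => ?_, fun O => ?_⟩
  · exact ⟨_, AnswersCorrectly.of_deterministic (N i) A⟩
  · rw [D.machine_language Function.surjective_id hg hM hN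
      fun i => AnswersCorrectly.of_deterministic (N i) _, language_eq_verifiedLanguage]
    congr 1
    funext i
    exact answered_some (hN i) _

/-- Two oracles can be merged into one. -/
theorem exists_machine_join {κ : Type} [Nonempty κ] {M : OTM (Fin 2) κ} (hM : M.PolyTime) :
    ∃ C : OTM Unit κ, C.PolyTime ∧ ∀ A, C.language (fun _ => join A) = M.language A := by
  obtain ⟨C, hC, h⟩ := exists_machine_of_deterministic (ι' := Unit) hM
    (N := fun i => tagAsk (i = 1)) (fun i => polyTime_tagAsk _) fun _ _ => ()
  refine ⟨C, hC, fun A => ?_⟩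
  rw [h]
  congr 1
  funext i
  rw [language_tagAsk]
  congr 1
  fin_cases i <;> simp [oracleOfBit]

/-- With an oracle in `Σ_m^p`, membership in `A` of the words in `V` can be verified: some machine
gives only correct answers, and gives an answer exactly for the words in `V`. -/
def Verifiable (m : ℕ) (A V : Lang) : Prop :=
  ∃ C ∈ SigmaP m, ∃ (κ : Type) (g : Bool → κ) (N : OTM Unit κ) (answer : Bool → Option Bool),
    Function.Surjective g ∧ N.PolyTime ∧ (∀ O, ∃ B, N.AnswersCorrectly answer O B) ∧
    N.AnswersCorrectly answer (fun _ => C) A ∧ N.answered answer (fun _ => C) = V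

/-- The answer is a guess "yes", given only on branches where the machine for `A` accepts. -/
theorem Verifiable.of_sigma {m : ℕ} {A : Lang} (hA : A ∈ SigmaP (m + 1)) :
    Verifiable m Set.univ A := by
  obtain ⟨C, hC, M, hM, rfl⟩ := hA
  have key : ∀ O, M.AnswersCorrectly (fun b => if b then some true else none) O Set.univ := by
    rintro O x c t (_ | _) a hb ha
    · simp at ha
    · simp only [if_true, Option.some.injEq] at ha
      simp [← ha]
  refine ⟨C, hC, Bool, id, M, fun b => if b then some true else none, Function.surjective_id, hM,
    fun O => ⟨_, key O⟩, key _, ?_⟩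
  rw [language_eq_verifiedLanguage, answered]
  congr 1
  funext b
  cases b <;> simp

/-- The answer is a guess "no", confirmed by an accepting branch for `A`. It is meant for `A` the
complement of the language queried. -/
theorem Verifiable.of_sigma_negative {m : ℕ} {A : Lang} (hA : A ∈ SigmaP (m + 1)) :
    Verifiable m ∅ A := by
  obtain ⟨C, hC, M, hM, rfl⟩ := hA
  have key : ∀ O, M.AnswersCorrectly (fun b => if b then some false else none) O ∅ := by
    rintro O x c t (_ | _) a hb ha
    · simp at ha
    · simp only [if_true, Option.some.injEq] at ha
      simp [← ha]
  refine ⟨C, hC, Bool, id, M, fun b => if b then some false else none, Function.surjective_id, hM,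
    fun O => ⟨_, key O⟩, key _, ?_⟩
  rw [language_eq_verifiedLanguage, answered]
  congr 1
  funext b
  cases b <;> simp

theorem Verifiable.of_delta {m : ℕ} {A : Lang} (hA : A ∈ DeltaP (m + 1)) :
    Verifiable m A Set.univ := by
  obtain ⟨C, hC, M, hM, rfl⟩ := hA
  exact ⟨C, hC, Unit, fun _ => (), M, some, fun _ => ⟨true, rfl⟩, hM,
    fun O => ⟨_, .of_deterministic M O⟩, .of_deterministic M _, answered_some hM _⟩

/-- The combined machine has one oracle in `Σ_m^p` for each query index, and these have to be
merged. Closure of `Σ_m^p` under `join` is a hypothesis because at level `m + 1` it is deduced from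
this lemma. -/
theorem verifiedLanguage_mem_sigma_of_join {m : ℕ}
    (hjoin : ∀ C : Fin 2 → Lang, (∀ i, C i ∈ SigmaP m) → join C ∈ SigmaP m) {κ₁ : Type}
    {M : OTM (Fin 2) κ₁} (hM : M.PolyTime) {f : Bool → κ₁} (hf : Function.Surjective f)
    {A V : Fin 2 → Lang} (hAV : ∀ i, Verifiable m (A i) (V i)) (outcome : Bool → Bool) :
    M.verifiedLanguage A V (fun b => outcome b = true) ∈ SigmaP (m + 1) := by
  choose C hC κ₂ g N answer hg hN hcons hA hV using hAV
  let D : Substitution (Fin 2) Unit (Fin 2) κ₁ Bool κ₂ :=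
    { outer := M, inner := N, oracle := fun i _ => i, outerChoice := f, innerChoice := g,
      answer := answer, outcome := outcome }
  have hD : D.machine.PolyTime := D.machine_polyTime hf hg hM hN hcons
  obtain ⟨M', hM', h⟩ := exists_machine_join hD
  refine ⟨join C, hjoin C hC, M', hM', ?_⟩
  rw [h, D.machine_language hf hg hM hN (𝒜 := A) hA]
  congr 1
  funext i
  exact (hV i).symm

theorem join_mem_sigma {m : ℕ} {C : Fin 2 → Lang} (hC : ∀ i, C i ∈ SigmaP m) :
    join C ∈ SigmaP m := by
  induction m generalizing C with
  | zero =>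
    choose N hN h using hC
    obtain ⟨M, hM, hM'⟩ := exists_machine_of_deterministic (ι' := Empty) polyTime_popAsk hN
      fun _ j => j.elim
    refine ⟨M, hM, ?_⟩
    rw [hM', language_popAsk]
    congr 1
    funext i
    rw [h]
    congr 1
    funext j
    exact j.elim
  | succ m ih =>
    rw [← verifiedLanguage_popAsk]
    exact verifiedLanguage_mem_sigma_of_join (f := fun _ => ()) (fun _ => ih) polyTime_popAsk
      (fun _ => ⟨true, rfl⟩) (fun i => .of_sigma (hC i)) id

theorem verifiedLanguage_mem_sigma {m : ℕ} {κ₁ : Type}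
    {M : OTM (Fin 2) κ₁} (hM : M.PolyTime) {f : Bool → κ₁} (hf : Function.Surjective f)
    {A V : Fin 2 → Lang} (hAV : ∀ i, Verifiable m (A i) (V i)) (outcome : Bool → Bool) :
    M.verifiedLanguage A V (fun b => outcome b = true) ∈ SigmaP (m + 1) :=
  verifiedLanguage_mem_sigma_of_join (fun _ => join_mem_sigma) hM hf hAV outcome

/-! ### Inclusions and closure properties -/

theorem sigma_subset_delta_succ (m : ℕ) : SigmaP m ⊆ DeltaP (m + 1) := by
  intro L hL
  refine ⟨L, hL, ask Unit {()} fun a => a (), polyTime_ask, ?_⟩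
  ext x
  simp [mem_language_ask]

/-- Answers for a language in `Δ_{m+1}^p` are always given, so `V` is everything; the second oracle
is only a filler. -/
theorem delta_succ_subset_sigma (m : ℕ) : DeltaP (m + 1) ⊆ SigmaP (m + 1) := by
  intro L hL
  convert verifiedLanguage_mem_sigma (m := m) (f := fun _ => ())
    (M := ask Unit {0} fun a => a 0) (A := fun _ => L) (V := fun _ => Set.univ) polyTime_ask
    (fun _ => ⟨true, rfl⟩) (fun _ => .of_delta hL) id
  ext x
  simp [mem_verifiedLanguage_ask]

theorem compl_mem_sigma_of_delta {m : ℕ} {L : Lang} (hL : L ∈ DeltaP (m + 1)) :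
    Lᶜ ∈ SigmaP (m + 1) := by
  convert verifiedLanguage_mem_sigma (m := m) (f := fun _ => ())
    (M := ask Unit {0} fun a => a 0) (A := fun _ => L) (V := fun _ => Set.univ) polyTime_ask
    (fun _ => ⟨true, rfl⟩) (fun _ => .of_delta hL) not
  ext x
  simp [mem_verifiedLanguage_ask]

theorem delta_succ_subset_sigma_inter_pi (m : ℕ) :
    DeltaP (m + 1) ⊆ SigmaP (m + 1) ∩ PiP (m + 1) :=
  fun _ hL => ⟨delta_succ_subset_sigma m hL, compl_mem_sigma_of_delta hL⟩

theorem delta_subset_sigma_inter_pi (m : ℕ) : DeltaP m ⊆ SigmaP m ∩ PiP m := by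
  cases m with
  | zero => exact fun L hL => ⟨hL, hL⟩
  | succ m => exact delta_succ_subset_sigma_inter_pi m

theorem delta_mono : Monotone DeltaP :=
  monotone_nat_of_le_succ fun m =>
    (delta_subset_sigma_inter_pi m).trans
      (Set.inter_subset_left.trans (sigma_subset_delta_succ m))

theorem sigma_subset_delta {m n : ℕ} (h : m < n) : SigmaP m ⊆ DeltaP n :=
  (sigma_subset_delta_succ m).trans (delta_mono h)

theorem sigma_inter_pi_mono : Monotone fun m => SigmaP m ∩ PiP m :=
  monotone_nat_of_le_succ fun m =>
    Set.inter_subset_left.trans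
      ((sigma_subset_delta_succ m).trans (delta_succ_subset_sigma_inter_pi m))

theorem empty_mem_delta (m : ℕ) : (∅ : Lang) ∈ DeltaP m := by
  refine delta_mono (Nat.zero_le m) ⟨ask Unit ∅ fun _ => false, polyTime_ask, ?_⟩
  ext x
  simp [mem_language_ask]

theorem univ_mem_delta (m : ℕ) : (Set.univ : Lang) ∈ DeltaP m := by
  refine delta_mono (Nat.zero_le m) ⟨ask Unit ∅ fun _ => true, polyTime_ask, ?_⟩
  ext x
  simp [mem_language_ask]

/-- Guess which of the two languages contains the input, then verify it. -/
theorem union_mem_sigma {m : ℕ} {A B : Lang} (hA : A ∈ SigmaP (m + 1)) (hB : B ∈ SigmaP (m + 1)) :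
    A ∪ B ∈ SigmaP (m + 1) := by
  rw [show A ∪ B = ![A, B] 0 ∪ ![A, B] 1 from rfl, ← verifiedLanguage_guessAsk]
  refine verifiedLanguage_mem_sigma polyTime_guessAsk Function.surjective_id (fun i => ?_) id
  fin_cases i
  · exact .of_sigma hA
  · exact .of_sigma hB

/-- Both queries are presumed positive, and both must be verified. -/
theorem inter_mem_sigma {m : ℕ} {A B : Lang} (hA : A ∈ SigmaP (m + 1)) (hB : B ∈ SigmaP (m + 1)) :
    A ∩ B ∈ SigmaP (m + 1) := by
  convert verifiedLanguage_mem_sigma (m := m) (f := fun _ => ())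
    (M := ask Unit Finset.univ fun _ => true) (A := fun _ => Set.univ) (V := ![A, B]) polyTime_ask
    (fun _ => ⟨true, rfl⟩) (fun i => ?_) id
  · ext x
    simp [mem_verifiedLanguage_ask, Fin.forall_fin_two]
  · fin_cases i
    · exact .of_sigma hA
    · exact .of_sigma hB

/-- `Δ_{m+1}^p` is closed under polynomial time with two oracles. -/
theorem language_mem_delta {m : ℕ} {M : DTM (Fin 2)} (hM : M.PolyTime) {A : Fin 2 → Lang}
    (hA : ∀ i, A i ∈ DeltaP (m + 1)) : M.language A ∈ DeltaP (m + 1) := by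
  choose C hC N hN h using hA
  obtain ⟨M₁, hM₁, h₁⟩ := exists_machine_of_deterministic (ι' := Fin 2) hM hN fun i _ => i
  obtain ⟨M₂, hM₂, h₂⟩ := exists_machine_join hM₁
  refine ⟨join C, join_mem_sigma hC, M₂, hM₂, ?_⟩
  rw [h₂, h₁]
  congr 1
  funext i
  exact h i

/-- `P` is closed under polynomial time with two oracles. -/
theorem language_mem_P {M : DTM (Fin 2)} (hM : M.PolyTime) {A : Fin 2 → Lang}
    (hA : ∀ i, A i ∈ P) : M.language A ∈ P := by
  choose N hN h using hA
  obtain ⟨M₁, hM₁, h₁⟩ := exists_machine_of_deterministic (ι' := Empty) hM hN fun _ j => j.elim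
  refine ⟨M₁, hM₁, ?_⟩
  rw [h₁]
  congr 1
  funext i
  rw [h]
  congr 1
  funext j
  exact j.elim

/-! ### Machines with one query to each oracle: guessing the answers. -/

open OTM

namespace OTM

variable {ι ι' κ : Type} {M : OTM ι κ}

/-- Runs with oracles that give the same answers to all queries are the same. -/
theorem run_congr {A B : ι → Lang} {c : ℕ → κ} {x : List Bool} {t : ℕ}
    (h : ∀ u < t, M.Verified (fun i => {w | w ∈ A i ↔ w ∈ B i}) (M.run A c x u)) :
    M.run B c x t = M.run A c x t := by
  induction t with
  | zero => rfl
  | succ t ih =>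
    rw [run, run, ih fun u hu => h u (by omega)]
    have ht := h t (by omega)
    generalize M.run A c x t = s at ht
    rcases hq : M.instr s.state with ⟨k, b, q'⟩ | ⟨k, next⟩ | next | ⟨S, next⟩ | b <;>
      simp only [step, hq]
    congr 2
    funext i
    congr 1
    rw [eq_iff_iff]
    refine and_congr_right fun hi => ?_
    exact (ht S next hq i hi).symm

theorem log_step_of_query {A : ι → Lang} {c : κ} {s : M.Cfg} {S : Finset ι}
    {next : (ι → Bool) → M.Q} (hs : M.instr s.state = .query S next) :
    (M.step A c s).log = s.log ++ [S] := by
  simp only [step, hs]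

theorem log_run_prefix (A : ι → Lang) (c : ℕ → κ) (x : List Bool) {t u : ℕ} (htu : t ≤ u) :
    (M.run A c x t).log <+: (M.run A c x u).log := by
  induction u, htu using Nat.le_induction with
  | base => exact List.prefix_rfl
  | succ u _ ih =>
    refine ih.trans ?_
    rw [run]
    generalize M.run A c x u = s
    rcases hq : M.instr s.state with ⟨k, b, q'⟩ | ⟨k, next⟩ | next | ⟨S, next⟩ | b <;>
      simp only [step, hq] <;> simp

/-- In every computation, at most one step queries the oracle `i`. -/
def QueriesOnce (M : OTM ι κ) (i : ι) : Prop :=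
  ∀ (A : ι → Lang) (c : ℕ → κ) (x : List Bool) (t u : ℕ) (S S' : Finset ι)
    (next next' : (ι → Bool) → M.Q), M.instr (M.run A c x t).state = .query S next →
    M.instr (M.run A c x u).state = .query S' next' → i ∈ S → i ∈ S' → t = u

end OTM

/-- No two query steps of a computation with the restriction `R` query the oracle `i`. -/
def AllowsOnce {ι : Type} (R : List (Finset ι) → Prop) (i : ι) : Prop :=
  ∀ l, R l → ∀ S S', [S, S'].Sublist l → i ∈ S → i ∉ S'

namespace OTM

variable {ι ι' κ : Type} {M : OTM ι κ}

/-- Logs only grow, so query steps at times `t < u` leave `[S, S']` as a sublist of the log at time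
`u + 1`. -/
theorem Restricted.queriesOnce {R : List (Finset ι) → Prop} (hM : M.Restricted R) {i : ι}
    (hR : AllowsOnce R i) : M.QueriesOnce i := by
  have key : ∀ (A : ι → Lang) (c : ℕ → κ) (x : List Bool) (t u : ℕ) (S S' : Finset ι)
      (next next' : (ι → Bool) → M.Q), M.instr (M.run A c x t).state = .query S next →
      M.instr (M.run A c x u).state = .query S' next' → i ∈ S → i ∈ S' → ¬ t < u := by
    intro A c x t u S S' next next' ht hu hS hS' htu
    refine hR _ (hM A c x (u + 1)) S S' ?_ hS hS'
    rw [run, log_step_of_query hu]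
    have h1 := log_run_prefix (M := M) A c x (Nat.succ_le_of_lt htu)
    rw [Nat.succ_eq_add_one, run, log_step_of_query ht] at h1
    exact ((List.sublist_append_right _ [S]).trans h1.sublist).append
      (List.Sublist.refl [S'])
  intro A c x t u S S' next next' ht hu hS hS'
  rcases lt_trichotomy t u with h | h | h
  · exact absurd h (key A c x t u S S' next next' ht hu hS hS')
  · exact h
  · exact absurd h (key A c x u t S' S next' next hu ht hS' hS)

theorem compl_language_eq_verifiedLanguage {M : DTM ι} (hM : M.PolyTime) (A : ι → Lang) :
    (M.language A)ᶜ =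
      M.verifiedLanguage A (fun _ => Set.univ) (fun b => (!b) = true) := by
  obtain ⟨p, hp⟩ := hM
  ext x
  obtain ⟨b, hb⟩ := hp A (fun _ => ()) x
  have hc : ∀ c : ℕ → Unit, c = fun _ => () := fun _ => rfl
  rw [Set.mem_compl_iff, language_iff_of_halts fun c => hp A c x,
    verifiedLanguage_iff_of_halts fun c => hp A c x]
  have hv : ∀ c u, M.Verified (fun _ => Set.univ) (M.run A c x u) :=
    fun c u => verified_univ _
  have hb' : ∀ c, M.instr (M.run A c x (Polynomial.eval x.length p)).state = .halt b :=
    fun c => hb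
  simp [hb', hv]

end OTM

/-- Polynomial time with one query to each of two oracles in `Σ_{m+1}^p ∩ Π_{m+1}^p`. -/
theorem verifiedLanguage_mem_sigma_of_once {m : ℕ} {M : DTM (Fin 2)} (hM : M.PolyTime)
    (hone : ∀ i, M.QueriesOnce i) {A : Fin 2 → Lang}
    (hA : ∀ i, A i ∈ SigmaP (m + 1) ∩ PiP (m + 1)) (outcome : Bool → Bool) :
    M.verifiedLanguage A (fun _ => Set.univ) (fun b => outcome b = true) ∈ SigmaP (m + 1) := by
  -- The bit `b i` is a guess of the answer to the only query to oracle `i`. The oracle `guess b i`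
  -- gives this answer to every word, and `V b i` is the set of words for which it is right.
  let guess (b : Fin 2 → Bool) (i : Fin 2) : Lang := if b i then Set.univ else ∅
  let V (b : Fin 2 → Bool) (i : Fin 2) : Lang := if b i then A i else (A i)ᶜ
  let L (b : Fin 2 → Bool) : Lang :=
    M.verifiedLanguage (guess b) (V b) (fun b => outcome b = true)
  have hL : ∀ b, L b ∈ SigmaP (m + 1) := by
    intro b
    refine verifiedLanguage_mem_sigma (f := fun _ => ()) hM (fun _ => ⟨true, rfl⟩) (fun i => ?_)
      outcome
    by_cases hb : b i = true
    · simp only [guess, V, hb, if_true]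
      exact .of_sigma (hA i).1
    · simp only [guess, V, hb]
      exact .of_sigma_negative (hA i).2
  have hiff : ∀ b i w, w ∈ V b i ↔ (w ∈ guess b i ↔ w ∈ A i) := by
    intro b i w
    by_cases hb : b i = true <;> simp [V, guess, hb]
  have hunion : M.verifiedLanguage A (fun _ => Set.univ) (fun b => outcome b = true) =
      (L ![false, false] ∪ L ![false, true]) ∪ (L ![true, false] ∪ L ![true, true]) := by
    have hex : ∀ x, x ∈ (L ![false, false] ∪ L ![false, true]) ∪
        (L ![true, false] ∪ L ![true, true]) ↔ ∃ b, x ∈ L b := by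
      intro x
      constructor
      · rintro ((h | h) | (h | h)) <;> exact ⟨_, h⟩
      · rintro ⟨b, h⟩
        have hb : b = ![b 0, b 1] := by
          funext i
          fin_cases i <;> rfl
        rw [hb] at h
        cases h0 : b 0 <;> cases h1 : b 1 <;> rw [h0, h1] at h
        · exact .inl (.inl h)
        · exact .inl (.inr h)
        · exact .inr (.inl h)
        · exact .inr (.inr h)
    ext x
    rw [hex]
    constructor
    · rintro ⟨c, t, o, h1, h2, -⟩
      classical
      -- The true answers along the branch `c`. As oracle `i` is queried at most once, a positive
      -- answer at some step is the answer at every step that queries it.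
      let b : Fin 2 → Bool := fun i => decide (∃ u S next,
        M.instr (M.run A c x u).state = .query S next ∧ i ∈ S ∧
          (M.run A c x u).stk (M.qry i) ∈ A i)
      have hv : ∀ u, M.Verified (V b) (M.run A c x u) := by
        intro u S next hq i hi
        rw [hiff]
        have hb : ((M.run A c x u).stk (M.qry i) ∈ guess b i) ↔ b i = true := by
          by_cases hb : b i = true <;> simp [guess, hb]
        rw [hb]
        simp only [b, decide_eq_true_iff]
        constructor
        · rintro ⟨u', S', next', hq', hi', hw⟩
          rwa [hone i A c x u u' S S' next next' hq hq' hi hi']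
        · exact fun hw => ⟨u, S, next, hq, hi, hw⟩
      have hrun : ∀ u, M.run (guess b) c x u = M.run A c x u := by
        refine fun u => run_congr fun v _ S next hq i hi => ?_
        exact ((hiff b i _).1 (hv v S next hq i hi)).symm
      refine ⟨b, c, t, o, ?_, h2, fun u _ => ?_⟩
      · rw [hrun, h1]
      · rw [hrun]
        exact hv u
    · rintro ⟨b, c, t, o, h1, h2, h3⟩
      refine ⟨c, t, o, ?_, h2, fun _ _ => verified_univ _⟩
      rw [run_congr (A := guess b), h1]
      intro u hu S next hq i hi
      exact (hiff b i _).1 (h3 u hu S next hq i hi)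
  rw [hunion]
  exact union_mem_sigma (union_mem_sigma (hL _) (hL _)) (union_mem_sigma (hL _) (hL _))

theorem language_mem_sigma_inter_pi {k : ℕ} {M : DTM (Fin 2)} (hM : M.PolyTime)
    (hone : ∀ i, M.QueriesOnce i) {A : Fin 2 → Lang} (hA : ∀ i, A i ∈ SigmaP k ∩ PiP k) :
    M.language A ∈ SigmaP k ∩ PiP k := by
  cases k with
  | zero =>
    have := language_mem_P hM fun i => (hA i).1
    exact ⟨this, this⟩
  | succ m =>
    constructor
    · rw [language_eq_verifiedLanguage]
      exact verifiedLanguage_mem_sigma_of_once hM hone hA id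
    · change (M.language A)ᶜ ∈ SigmaP (m + 1)
      rw [compl_language_eq_verifiedLanguage hM]
      exact verifiedLanguage_mem_sigma_of_once hM hone hA not

/-! ### One query to `Σ_k^p` as a symmetric difference. -/

/-- The machine that queries both oracles about its input, and accepts if exactly one of the answers
is positive. -/
abbrev askXor : DTM (Fin 2) :=
  ask Unit Finset.univ fun a => xor (a 0) (a 1)

theorem language_askXor (A : Fin 2 → Lang) : askXor.language A = symmDiff (A 0) (A 1) := by
  ext x
  rw [mem_language_ask, Set.mem_symmDiff]
  by_cases h0 : x ∈ A 0 <;> by_cases h1 : x ∈ A 1 <;> simp [h0, h1]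

theorem symmDiff_mem_delta {m : ℕ} {A B : Lang} (hA : A ∈ DeltaP (m + 1))
    (hB : B ∈ DeltaP (m + 1)) : symmDiff A B ∈ DeltaP (m + 1) := by
  have := language_mem_delta (M := askXor) polyTime_ask (A := ![A, B])
    (Fin.forall_fin_two.2 ⟨hA, hB⟩)
  rwa [language_askXor] at this

/-- A single query to a language in `Σ_k^p` changes a language in `Δ_j^p` only by a set in
`Σ_k^p`. -/
theorem exists_symmDiff {j k : ℕ} (hj : 0 < j) (hjk : j ≤ k) {M : DTM (Fin 2)} (hM : M.PolyTime)
    {s : Fin 2} (hone : M.QueriesOnce s) {A : Fin 2 → Lang} (hs : A s ∈ SigmaP k)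
    (hA : ∀ i ≠ s, A i ∈ DeltaP j) :
    ∃ B ∈ DeltaP j, ∃ C ∈ SigmaP k, M.language A = symmDiff B C := by
  obtain ⟨j, rfl⟩ : ∃ j', j = j' + 1 := ⟨j - 1, by omega⟩
  obtain ⟨k, rfl⟩ : ∃ k', k = k' + 1 := ⟨k - 1, by omega⟩
  -- `A₀` and `A₁` answer "no" and "yes" to every query to `s`, and are as simple as the other
  -- oracle.
  let A₀ := Function.update A s ∅
  let A₁ := Function.update A s Set.univ
  let V := Function.update (fun _ => Set.univ) s (A s)
  have hA₀ : M.language A₀ ∈ DeltaP (j + 1) := by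
    refine language_mem_delta hM fun i => ?_
    by_cases hi : i = s
    · simpa [A₀, hi] using empty_mem_delta _
    · simpa [A₀, hi] using hA i hi
  have hA₁ : M.language A₁ ∈ DeltaP (j + 1) := by
    refine language_mem_delta hM fun i => ?_
    by_cases hi : i = s
    · simpa [A₁, hi] using univ_mem_delta _
    · simpa [A₁, hi] using hA i hi
  -- The outcome is disregarded. Inputs whose run makes no query to `s` also belong to `W`.
  let W := M.verifiedLanguage A₁ V fun _ => true = true
  have hW : W ∈ SigmaP (k + 1) := by
    refine verifiedLanguage_mem_sigma (f := fun _ => ()) hM (fun _ => ⟨true, rfl⟩) (fun i => ?_)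
      fun _ => true
    by_cases hi : i = s
    · subst hi
      simpa [A₁, V] using Verifiable.of_sigma hs
    · simpa [A₁, V, hi] using Verifiable.of_delta (delta_mono hjk (hA i hi))
  -- The language agrees with that of `A₁` on `W` and with that of `A₀` off `W`, so it differs from
  -- the latter exactly where `x ∈ W` and the two disagree.
  refine ⟨_, hA₀, _, inter_mem_sigma hW (delta_subset_sigma_inter_pi _
    (delta_mono hjk (symmDiff_mem_delta hA₀ hA₁))).1, ?_⟩
  have hAA₁ : ∀ i w, w ∈ V i → (w ∈ A₁ i ↔ w ∈ A i) := by
    intro i w hw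
    by_cases hi : i = s
    · subst hi
      simpa [A₁, V] using hw
    · simp [A₁, hi]
  have hpos : ∀ x ∈ W, (x ∈ M.language A ↔ x ∈ M.language A₁) := by
    rintro x ⟨c, t, o, h1, -, h3⟩
    have hrun : M.run A c x t = M.run A₁ c x t :=
      run_congr fun u hu S next hq i hi => hAA₁ i _ (h3 u hu S next hq i hi)
    rw [← AnswersCorrectly.of_deterministic M A x c t o o (by rw [hrun, h1]) rfl,
      ← AnswersCorrectly.of_deterministic M A₁ x c t o o h1 rfl]
  have hneg : ∀ x ∉ W, (x ∈ M.language A ↔ x ∈ M.language A₀) := by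
    intro x hx
    obtain ⟨p, hp⟩ := hM
    let c : ℕ → Unit := fun _ => ()
    -- Up to the first unverified query the run with `A₁` is the true one. That query is to `s` and
    -- its true answer is "no".
    have hfail : ∃ u, ¬ M.Verified V (M.run A₁ c x u) := by
      by_contra! h
      obtain ⟨o, ho⟩ := hp A₁ c x
      exact hx ⟨c, _, o, ho, rfl, fun u _ => h u⟩
    classical
    have hu := Nat.find_spec hfail
    have hlt := fun v (hv : v < Nat.find hfail) => not_not.1 (Nat.find_min hfail hv)
    set u := Nat.find hfail
    have hrun : M.run A c x u = M.run A₁ c x u :=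
      run_congr fun v hv S next hq i hi => hAA₁ i _ (hlt v hv S next hq i hi)
    rw [← hrun] at hu
    simp only [Verified, not_forall] at hu
    obtain ⟨S, next, hq, i, hi, hw⟩ := hu
    obtain rfl : i = s := by
      by_contra his
      simp [V, his] at hw
    have hw' : (M.run A c x u).stk (M.qry i) ∉ A i := by simpa [V] using hw
    -- No other step queries `s`, so "no" is right throughout and the whole true run is the run with
    -- `A₀`.
    have hrun₀ : ∀ t, M.run A₀ c x t = M.run A c x t := by
      refine fun t => run_congr fun v _ S' next' hq' i' hi' => ?_
      by_cases hii : i' = i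
      · subst hii
        obtain rfl := hone A c x v u S' S next' next hq' hq hi' hi
        simp [A₀, hw']
      · simp [A₀, hii]
    obtain ⟨o, ho⟩ := hp A c x
    rw [← AnswersCorrectly.of_deterministic M A x c _ o o ho rfl,
      ← AnswersCorrectly.of_deterministic M A₀ x c _ o o (by rw [hrun₀, ho]) rfl]
  ext x
  rw [Set.mem_symmDiff, Set.mem_inter_iff, Set.mem_symmDiff]
  by_cases hx : x ∈ W
  · have := hpos x hx
    tauto
  · have := hneg x hx
    tauto

/-! ### Query logs, and machines for symmetric differences. -/

open OTM

namespace OTM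

/-- `J` is an invariant of the states of `M` and the lists of queries made so far, where a query
step about `S` contributes `e S`. -/
structure LogInvariant {ι ι' κ : Type} (M : OTM ι κ) (e : Finset ι → List (Finset ι'))
    (J : M.Q → List (Finset ι') → Prop) : Prop where
  start : J M.start []
  push {q l k b q'} : M.instr q = .push k b q' → J q l → J q' l
  pop {q l k next} (o) : M.instr q = .pop k next → J q l → J (next o) l
  branch {q l next} (c) : M.instr q = .branch next → J q l → J (next c) l
  query {q l S next} (a) : M.instr q = .query S next → J q l → J (next a) (l ++ e S)

theorem LogInvariant.of_forall {ι ι' κ : Type} {M : OTM ι κ} {e : Finset ι → List (Finset ι')}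
    {J : M.Q → List (Finset ι') → Prop} (hstart : J M.start [])
    (h : ∀ q l, J q l → match M.instr q with
      | .push _ _ q' => J q' l
      | .pop _ next => ∀ o, J (next o) l
      | .branch next => ∀ c, J (next c) l
      | .query S next => ∀ a, J (next a) (l ++ e S)
      | .halt _ => True) : M.LogInvariant e J where
  start := hstart
  push {q l k b q'} hq hl := by simpa only [hq] using h q l hl
  pop {q l k next} o hq hl := by
    have := h q l hl
    simp only [hq] at this
    exact this o
  branch {q l next} c hq hl := by
    have := h q l hl
    simp only [hq] at this
    exact this c
  query {q l S next} a hq hl := by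
    have := h q l hl
    simp only [hq] at this
    exact this a

theorem LogInvariant.run {ι κ : Type} {M : OTM ι κ} {J : M.Q → List (Finset ι) → Prop}
    (h : M.LogInvariant (fun S => [S]) J) (A : ι → Lang) (c : ℕ → κ) (x : List Bool) (t : ℕ) :
    J (M.run A c x t).state (M.run A c x t).log := by
  induction t with
  | zero => exact h.start
  | succ t ih =>
    rw [OTM.run]
    generalize M.run A c x t = s at ih
    rcases hq : M.instr s.state with ⟨k, b, q'⟩ | ⟨k, next⟩ | next | ⟨S, next⟩ | b <;>
      simp only [step, hq]
    · exact h.push hq ih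
    · exact h.pop _ hq ih
    · exact h.branch _ hq ih
    · exact h.query _ hq ih
    · exact ih

theorem logInvariant_ask {ι ι' κ : Type} (S : Finset ι) (decision : (ι → Bool) → Bool)
    (e : Finset ι → List (Finset ι')) :
    (ask κ S decision).LogInvariant e fun q l => l = Option.elim q [] fun _ => e S where
  start := rfl
  push {q l k b q'} h := by cases q <;> cases h
  pop {q l k next} o h := by cases q <;> cases h
  branch {q l next} c h := by cases q <;> cases h
  query {q l S next} a h := by
    cases q
    · cases h
      rintro rfl
      rfl
    · cases h

theorem restricted_ask {ι κ : Type} {S : Finset ι} {decision : (ι → Bool) → Bool}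
    {R : List (Finset ι) → Prop} (h0 : R []) (h1 : R [S]) :
    (ask κ S decision).Restricted R := by
  intro A c x t
  have := (logInvariant_ask (κ := κ) S decision fun S => [S]).run A c x t
  rw [this]
  cases ((ask κ S decision).run A c x t).state
  · exact h0
  · exact h1

end OTM

/-- The queries made when a machine that works for the oracle `i` queries its own oracles. -/
def queriesFor (i : Fin 2) (S : Finset Unit) : List (Finset (Fin 2)) :=
  if S.Nonempty then [{i}] else []

/-- The exclusive disjunction of two deterministic machines. -/
noncomputable def xorMachine (N : Fin 2 → DTM Unit) :
    Substitution (Fin 2) Unit (Fin 2) Unit Unit fun _ => Unit where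
  outer := askXor
  inner := N
  oracle i _ := i
  outerChoice := id
  innerChoice _ := id
  answer _ := some
  outcome := id

section XorMachine

variable {N : Fin 2 → DTM Unit}

theorem polyTime_xorMachine (hN : ∀ i, (N i).PolyTime) : (xorMachine N).machine.PolyTime :=
  (xorMachine N).machine_polyTime Function.surjective_id (fun _ => Function.surjective_id)
    polyTime_ask hN fun i A => ⟨_, .of_deterministic (N i) A⟩

theorem language_xorMachine (hN : ∀ i, (N i).PolyTime) (O : Fin 2 → Lang) :
    (xorMachine N).machine.language O =
      symmDiff ((N 0).language fun _ => O 0) ((N 1).language fun _ => O 1) := by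
  rw [(xorMachine N).machine_language Function.surjective_id (fun _ => Function.surjective_id)
    polyTime_ask hN fun i => .of_deterministic (N i) _]
  refine Eq.trans ?_ (language_askXor fun i => (N i).language fun _ => O i)
  rw [language_eq_verifiedLanguage]
  congr 1
  funext i
  exact answered_some (hN i) _

variable (J : ∀ i, (N i).Q → List (Finset (Fin 2)) → Prop)

/-- The lists of queries that may precede the answer to the query `i`, where `R` are the queries
that have not been answered. -/
def XorBefore (R : Finset (Fin 2)) (i : Fin 2) (l : List (Finset (Fin 2))) : Prop :=
  (i = 0 ∧ R = Finset.univ ∧ l = []) ∨ (i = 1 ∧ R = {1} ∧ ∃ q, J 0 q l)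

/-- The lists of queries when both queries have been answered. -/
def XorDone (l : List (Finset (Fin 2))) : Prop :=
  ∃ l₀ l₁ q₀ q₁, l = l₀ ++ l₁ ∧ J 0 q₀ l₀ ∧ J 1 q₁ l₁

/-- The lists of queries when the queries in `R` have not been answered. -/
def XorTask (q : Option Bool) (R : Finset (Fin 2)) (l : List (Finset (Fin 2))) : Prop :=
  q = none ∧ ((R = Finset.univ ∧ l = []) ∨ (R = {1} ∧ ∃ q, J 0 q l) ∨ (R = ∅ ∧ XorDone J l))

/-- The invariant of `xorMachine N`. -/
def XorInvariant : (xorMachine N).State → List (Finset (Fin 2)) → Prop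
  | .main (.inl q), l => (q = (none : Option Bool) ∧ l = []) ∨
      (q ≠ (none : Option Bool) ∧ XorDone J l)
  | .main (.inr x), l => XorTask J x.1 x.2.1 l
  | .clear _ (.inl q), l => q ≠ (none : Option Bool) ∧ XorDone J l
  | .clear _ (.inr x), l => XorTask J x.1 x.2.1 l
  | .unload x i, l => x.1 = (none : Option Bool) ∧ XorBefore J x.2.1 i l
  | .unloadPush x i _, l => x.1 = (none : Option Bool) ∧ XorBefore J x.2.1 i l
  | .load x i, l => x.1 = (none : Option Bool) ∧ XorBefore J x.2.1 i l
  | .loadPush x i _, l => x.1 = (none : Option Bool) ∧ XorBefore J x.2.1 i l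
  | .loadPush' x i _, l => x.1 = (none : Option Bool) ∧ XorBefore J x.2.1 i l
  | .work x i q, l => x.1 = (none : Option Bool) ∧
      ∃ l₀ l₁, l = l₀ ++ l₁ ∧ XorBefore J x.2.1 i l₀ ∧ J i q l₁

variable {J}

/-- Machine `0` finishes before machine `1` starts, so the log is always a log of the former
followed by a log of the latter. The set of unanswered queries tells which of them is at work. -/
theorem logInvariant_xorMachine (hJ : ∀ i, (N i).LogInvariant (queriesFor i) (J i)) :
    (xorMachine N).machine.LogInvariant (fun S => [S]) (XorInvariant J) := by
  classical
  refine .of_forall (.inl ⟨rfl, rfl⟩) fun q l hl => ?_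
  rcases q with ((_ | b) | ⟨q, R, a⟩) | ⟨T, r⟩ | ⟨x, i⟩ | ⟨x, i, b⟩ | ⟨x, i⟩ | ⟨x, i, b⟩ |
    ⟨x, i, b⟩ | ⟨x, i, q⟩
  · obtain ⟨-, rfl⟩ | ⟨h, -⟩ := hl
    · exact fun _ => ⟨rfl, .inl ⟨rfl, rfl⟩⟩
    · exact absurd rfl h
  · trivial
  · obtain ⟨hq, h⟩ := hl
    dsimp only at hq h
    subst hq
    dsimp only [Substitution.program]
    rcases h with ⟨rfl, rfl⟩ | ⟨rfl, h⟩ | ⟨rfl, h⟩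
    · rw [dif_pos Finset.univ_nonempty]
      exact fun _ => ⟨rfl, .inl ⟨rfl, rfl, rfl⟩⟩
    · rw [dif_pos (Finset.singleton_nonempty _)]
      exact fun _ => ⟨rfl, .inr ⟨by simp, rfl, h⟩⟩
    · rw [dif_neg Finset.not_nonempty_empty]
      exact fun _ => ⟨by rintro ⟨⟩, h⟩
  · dsimp only [Substitution.program]
    by_cases hT : T.Nonempty
    · rw [dif_pos hT]
      rcases r with r | r <;> rintro (_ | o) <;> exact hl
    · rw [dif_neg hT]
      intro _
      rcases r with r | r
      · exact .inr hl
      · exact hl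
  · rintro (_ | o) <;> exact hl
  · exact hl
  · rintro (_ | o)
    · exact ⟨hl.1, l, [], by simp, hl.2, (hJ i).start⟩
    · exact hl
  · exact hl
  · exact hl
  · obtain ⟨hx, l₀, l₁, rfl, h₀, h₁⟩ := hl
    dsimp only [Substitution.program]
    rcases hq : ((xorMachine N).inner i).instr q with ⟨k, b, q'⟩ | ⟨k, next⟩ | next | ⟨S, next⟩ | b
    · exact ⟨hx, l₀, l₁, rfl, h₀, (hJ i).push hq h₁⟩
    · exact fun o => ⟨hx, l₀, l₁, rfl, h₀, (hJ i).pop o hq h₁⟩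
    · exact fun c => ⟨hx, l₀, l₁, rfl, h₀, (hJ i).branch _ hq h₁⟩
    · have key := fun a => (hJ i).query a hq h₁
      dsimp only
      by_cases hS : S.Nonempty
      · rw [if_pos hS]
        refine fun a => ⟨hx, l₀, _, List.append_assoc _ _ _, h₀, ?_⟩
        have he : queriesFor i S = [S.image ((xorMachine N).oracle i)] := by
          rw [queriesFor, if_pos hS]
          congr 1
          exact (Finset.image_const hS i).symm
        have := key fun j => a ((xorMachine N).oracle i j)
        rw [he] at this
        convert this
      · rw [if_neg hS]
        refine fun _ => ⟨hx, l₀, l₁, rfl, h₀, ?_⟩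
        have := key fun _ => false
        rwa [queriesFor, if_neg hS, List.append_nil] at this
    · refine fun _ => ⟨hx, ?_⟩
      rcases h₀ with ⟨rfl, hR, rfl⟩ | ⟨rfl, hR, q₀, h₀⟩
      · refine .inr (.inl ⟨?_, q, h₁⟩)
        dsimp only
        rw [hR]
        rfl
      · refine .inr (.inr ⟨?_, l₀, l₁, q₀, q, rfl, h₀, h₁⟩)
        dsimp only
        rw [hR]
        rfl

theorem restricted_xorMachine (hJ : ∀ i, (N i).LogInvariant (queriesFor i) (J i))
    {R : List (Finset (Fin 2)) → Prop}
    (hR : ∀ q₀ l₀ q₁ l₁, J 0 q₀ l₀ → J 1 q₁ l₁ → R (l₀ ++ l₁)) :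
    (xorMachine N).machine.Restricted R := by
  have hnil : R [] := hR _ [] _ [] (hJ 0).start (hJ 1).start
  have hzero : ∀ q₀ l, J 0 q₀ l → R l := fun q₀ l h => by
    simpa using hR q₀ l _ [] h (hJ 1).start
  have hdone : ∀ l, XorDone J l → R l := by
    rintro _ ⟨l₀, l₁, q₀, q₁, rfl, h₀, h₁⟩
    exact hR _ _ _ _ h₀ h₁
  have htask : ∀ q S l, XorTask J q S l → R l := by
    rintro q S l ⟨-, ⟨-, rfl⟩ | ⟨-, q, h⟩ | ⟨-, h⟩⟩
    · exact hnil
    · exact hzero q l h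
    · exact hdone l h
  have hbefore : ∀ S i l, XorBefore J S i l → R l := by
    rintro S i l (⟨-, -, rfl⟩ | ⟨-, -, q, h⟩)
    · exact hnil
    · exact hzero q l h
  have key : ∀ (q : (xorMachine N).State) l, XorInvariant J q l → R l := by
    intro q l hl
    rcases q with (q | x) | ⟨T, q | x⟩ | ⟨x, i⟩ | ⟨x, i, b⟩ | ⟨x, i⟩ | ⟨x, i, b⟩ |
      ⟨x, i, b⟩ | ⟨x, i, q⟩
    · obtain ⟨-, rfl⟩ | ⟨-, h⟩ := hl
      · exact hnil
      · exact hdone l h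
    · exact htask _ _ _ hl
    · exact hdone l hl.2
    · exact htask _ _ _ hl
    · exact hbefore _ _ _ hl.2
    · exact hbefore _ _ _ hl.2
    · exact hbefore _ _ _ hl.2
    · exact hbefore _ _ _ hl.2
    · exact hbefore _ _ _ hl.2
    · obtain ⟨-, l₀, l₁, rfl, ⟨rfl, -, rfl⟩ | ⟨rfl, -, q₀, h₀⟩, h₁⟩ := hl
      · exact hzero q l₁ h₁
      · exact hR _ _ _ _ h₀ h₁
  exact fun A c x t => key _ _ ((logInvariant_xorMachine hJ).run A c x t)

end XorMachine

/-- The machine that accepts the words in its oracle. -/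
abbrev askOracle : DTM Unit :=
  ask Unit {()} fun a => a ()

theorem language_askOracle (A : Lang) : askOracle.language (fun _ => A) = A := by
  ext x
  simp [mem_language_ask]

theorem queriesFor_singleton (i : Fin 2) : queriesFor i {()} = [{i}] := by
  simp [queriesFor]

theorem elim_sublist (q : Option Bool) (i : Fin 2) :
    (Option.elim q [] fun _ => queriesFor i {()}).Sublist [{i}] := by
  rw [queriesFor_singleton]
  cases q <;> simp

theorem symmDiff_mem_POrdered {C D : CClass} {A B : Lang} (hA : A ∈ C) (hB : B ∈ D) :
    symmDiff A B ∈ POrdered C D := by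
  have hN : ∀ _ : Fin 2, askOracle.PolyTime := fun _ => polyTime_ask
  refine ⟨A, hA, B, hB, _, polyTime_xorMachine hN,
    restricted_xorMachine (fun i => logInvariant_ask _ _ _) ?_, ?_⟩
  · rintro q₀ _ q₁ _ rfl rfl
    exact (elim_sublist q₀ 0).append (elim_sublist q₁ 1)
  · simp [language_xorMachine hN, language_askOracle]

theorem symmDiff_mem_PParallel {C D : CClass} {A B : Lang} (hA : A ∈ C) (hB : B ∈ D) :
    symmDiff A B ∈ PParallel C D :=
  ⟨A, hA, B, hB, askXor, polyTime_ask, restricted_ask (by simp) (by simp),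
    (language_askXor ![A, B]).symm⟩

/-- The one query to `C` comes first; then the machine for `B` contributes only queries to oracle
`1`. -/
theorem symmDiff_mem_POnePoly {C D : CClass} {A B : Lang} (hA : A ∈ C) (hB : B ∈ PRel D) :
    symmDiff A B ∈ POnePoly C D := by
  obtain ⟨E, hE, M, hM, rfl⟩ := hB
  let N : Fin 2 → DTM Unit := ![askOracle, M]
  have hN : ∀ i, (N i).PolyTime := Fin.forall_fin_two.2 ⟨polyTime_ask, hM⟩
  let J : ∀ i, (N i).Q → List (Finset (Fin 2)) → Prop :=
    Fin.cases (fun (q : Option Bool) l => l = Option.elim q [] fun _ => queriesFor 0 {()})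
      (Fin.cases (fun (_ : M.Q) l => ∀ S ∈ l, S = {1}) fun i => i.elim0)
  have hJ₁ : M.LogInvariant (queriesFor 1) fun _ l => ∀ S ∈ l, S = {1} :=
    { start := by simp
      push := fun _ h => h
      pop := fun _ _ h => h
      branch := fun _ _ h => h
      query := by
        intro q l S next a _ h S' hS'
        rcases List.mem_append.1 hS' with h' | h'
        · exact h S' h'
        · rw [queriesFor] at h'
          split_ifs at h'
          · simpa using h'
          · simp at h' }
  have hJ : ∀ i, (N i).LogInvariant (queriesFor i) (J i) :=
    Fin.forall_fin_two.2 ⟨logInvariant_ask _ _ _, hJ₁⟩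
  refine ⟨A, hA, E, hE, _, polyTime_xorMachine hN, restricted_xorMachine hJ ?_, ?_⟩
  · rintro (q₀ : Option Bool) l₀ q₁ l₁ (rfl : l₀ = _) (h₁ : ∀ S ∈ l₁, S = {1})
    have h₀ := elim_sublist q₀ 0
    have hc : l₁.count {0} = 0 := by
      rw [List.count_eq_zero]
      exact fun h => by simpa using h₁ _ h
    refine ⟨fun S hS => ?_, ?_⟩
    · rcases List.mem_append.1 hS with h | h
      · exact .inl (by simpa using h₀.subset h)
      · exact .inr (h₁ S h)
    · rw [List.count_append, hc, add_zero]
      exact (h₀.count_le _).trans (by simp)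
  · rw [language_xorMachine hN]
    simp [N, language_askOracle]

/-! ### The classes with two oracles -/

theorem subset_PTwo_left {R : List (Finset (Fin 2)) → Prop} {C D : CClass} (h0 : R []) (h1 : R [{0}])
    (hD : D.Nonempty) : C ⊆ PTwo R C D := by
  intro L hL
  obtain ⟨B, hB⟩ := hD
  refine ⟨L, hL, B, hB, ask Unit {0} fun a => a 0, polyTime_ask, restricted_ask h0 h1, ?_⟩
  ext x
  simp only [mem_language_ask, decide_eq_true_iff]
  simp

theorem subset_PTwo_right {R : List (Finset (Fin 2)) → Prop} {C D : CClass} (h0 : R [])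
    (h1 : R [{1}]) (hC : C.Nonempty) : D ⊆ PTwo R C D := by
  intro L hL
  obtain ⟨A, hA⟩ := hC
  refine ⟨A, hA, L, hL, ask Unit {1} fun a => a 1, polyTime_ask, restricted_ask h0 h1, ?_⟩
  ext x
  simp only [mem_language_ask, decide_eq_true_iff]
  simp

theorem allowsOnce_parallel (i : Fin 2) : AllowsOnce (fun l => l.length ≤ 1) i := by
  intro l hl S S' h
  have := h.length_le
  simp at this
  omega

/-- A two-element sublist of a two-element list is the whole list, and `1 - a` is the oracle other
than `a`. -/
theorem allowsOnce_of_sublist (a i : Fin 2) {l : List (Finset (Fin 2))}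
    (hl : l.Sublist [{a}, {1 - a}]) {S S' : Finset (Fin 2)} (h : [S, S'].Sublist l) (hi : i ∈ S) :
    i ∉ S' := by
  have := (h.trans hl).eq_of_length rfl
  simp only [List.cons.injEq, and_true] at this
  obtain ⟨rfl, rfl⟩ := this
  fin_cases a <;> fin_cases i <;> simp_all

theorem allowsOnce_ordered (i : Fin 2) : AllowsOnce (fun l => l.Sublist [{0}, {1}]) i :=
  fun _ hl _ _ h hi => allowsOnce_of_sublist 0 i hl h hi

theorem allowsOnce_anyOrder (i : Fin 2) :
    AllowsOnce (fun l => l.Sublist [{0}, {1}] ∨ l.Sublist [{1}, {0}]) i := by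
  rintro _ (hl | hl) _ _ h hi
  · exact allowsOnce_of_sublist 0 i hl h hi
  · exact allowsOnce_of_sublist 1 i hl h hi

theorem allowsOnce_onePoly :
    AllowsOnce (fun l : List (Finset (Fin 2)) =>
      (∀ S ∈ l, S = {0} ∨ S = {1}) ∧ l.count {0} ≤ 1) 0 := by
  rintro l ⟨h1, h2⟩ S S' h hS hS'
  have hS0 : S = {0} := (h1 S (h.subset (by simp))).resolve_right (by rintro rfl; simp at hS)
  have hS0' : S' = {0} := (h1 S' (h.subset (by simp))).resolve_right (by rintro rfl; simp at hS')
  subst hS0 hS0'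
  have := h.count_le {0}
  simp at this
  omega

/-- If `Z` is an upper and a lower bound for all classes with at most one query to each oracle, then
these classes are equal to `Z`. -/
theorem classes_eq {C D Z : CClass}
    (hle : ∀ R, (∀ i, AllowsOnce R i) → PTwo R C D ⊆ Z ∧ PTwo R D C ⊆ Z)
    (hparallel : Z ⊆ PParallel C D) (hordered : Z ⊆ POrdered C D) (hordered' : Z ⊆ POrdered D C) :
    PParallel C D = POrdered C D ∧ POrdered C D = POrdered D C ∧
      POrdered D C = PAnyOrder D C ∧ PAnyOrder D C = Z := by
  have h1 : PParallel C D = Z := (hle _ allowsOnce_parallel).1.antisymm hparallel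
  have h2 : POrdered C D = Z := (hle _ allowsOnce_ordered).1.antisymm hordered
  have h3 : POrdered D C = Z := (hle _ allowsOnce_ordered).2.antisymm hordered'
  have h4 : PAnyOrder D C = Z := by
    refine (hle _ allowsOnce_anyOrder).2.antisymm (hordered'.trans ?_)
    rintro L ⟨A, hA, B, hB, M, hM, hR, h⟩
    exact ⟨A, hA, B, hB, M, hM, fun O c x t => .inl (hR O c x t), h⟩
  rw [h1, h2, h3, h4]
  simp

/-- If `Z` lies in `C` or in `D`, one query to that class gives all lower bounds, with any member of
the other class as an idle oracle. -/
theorem classes_eq_of_mem {C D Z : CClass}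
    (hle : ∀ R, (∀ i, AllowsOnce R i) → PTwo R C D ⊆ Z ∧ PTwo R D C ⊆ Z)
    (hC : C.Nonempty) (hD : D.Nonempty) (hZ : Z ⊆ C ∨ Z ⊆ D) :
    PParallel C D = POrdered C D ∧ POrdered C D = POrdered D C ∧
      POrdered D C = PAnyOrder D C ∧ PAnyOrder D C = Z := by
  rcases hZ with hZ | hZ
  · exact classes_eq hle (hZ.trans (subset_PTwo_left (by simp) (by simp) hD))
      (hZ.trans (subset_PTwo_left (by simp) (by simp) hD))
      (hZ.trans (subset_PTwo_right (by simp) (by simp) hD))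
  · exact classes_eq hle (hZ.trans (subset_PTwo_right (by simp) (by simp) hC))
      (hZ.trans (subset_PTwo_right (by simp) (by simp) hC))
      (hZ.trans (subset_PTwo_left (by simp) (by simp) hC))

theorem PTwo_subset_delta {R : List (Finset (Fin 2)) → Prop} {C D : CClass} {m : ℕ}
    (hC : C ⊆ DeltaP (m + 1)) (hD : D ⊆ DeltaP (m + 1)) : PTwo R C D ⊆ DeltaP (m + 1) := by
  rintro _ ⟨A, hA, B, hB, M, hM, -, rfl⟩
  exact language_mem_delta hM (Fin.forall_fin_two.2 ⟨hC hA, hD hB⟩)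

theorem PTwo_subset_sigma_inter_pi {R : List (Finset (Fin 2)) → Prop} (hR : ∀ i, AllowsOnce R i)
    {C D : CClass} {k : ℕ} (hC : C ⊆ SigmaP k ∩ PiP k) (hD : D ⊆ SigmaP k ∩ PiP k) :
    PTwo R C D ⊆ SigmaP k ∩ PiP k := by
  rintro _ ⟨A, hA, B, hB, M, hM, hMR, rfl⟩
  exact language_mem_sigma_inter_pi hM (fun i => hMR.queriesOnce (hR i))
    (Fin.forall_fin_two.2 ⟨hC hA, hD hB⟩)

theorem PTwo_subset_symmDiff_left {R : List (Finset (Fin 2)) → Prop} (hR : AllowsOnce R 0)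
    {j k : ℕ} (hj : 0 < j) (hjk : j ≤ k) {D : CClass} (hD : D ⊆ DeltaP j) :
    PTwo R (SigmaP k) D ⊆ {L | ∃ B ∈ DeltaP j, ∃ C ∈ SigmaP k, L = symmDiff B C} := by
  rintro _ ⟨A, hA, B, hB, M, hM, hMR, rfl⟩
  refine exists_symmDiff hj hjk hM (hMR.queriesOnce hR) hA fun i hi => ?_
  obtain rfl : i = 1 := by omega
  exact hD hB

theorem PTwo_subset_symmDiff_right {R : List (Finset (Fin 2)) → Prop} (hR : AllowsOnce R 1)
    {j k : ℕ} (hj : 0 < j) (hjk : j ≤ k) {D : CClass} (hD : D ⊆ DeltaP j) :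
    PTwo R D (SigmaP k) ⊆ {L | ∃ B ∈ DeltaP j, ∃ C ∈ SigmaP k, L = symmDiff B C} := by
  rintro _ ⟨A, hA, B, hB, M, hM, hMR, rfl⟩
  refine exists_symmDiff hj hjk hM (hMR.queriesOnce hR) hB fun i hi => ?_
  obtain rfl : i = 0 := by omega
  exact hD hA

theorem delta_nonempty (m : ℕ) : (DeltaP m).Nonempty :=
  ⟨∅, empty_mem_delta m⟩

theorem sigma_inter_pi_nonempty (m : ℕ) : (SigmaP m ∩ PiP m).Nonempty :=
  (delta_nonempty m).mono (delta_subset_sigma_inter_pi m)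

end QueryOrder

open QueryOrder in
theorem corollaryc :
    (∀ j k : ℕ, 0 < j →
      PParallel (DeltaP j) (SigmaP k) = POrdered (DeltaP j) (SigmaP k) ∧
      POrdered (DeltaP j) (SigmaP k) = POrdered (SigmaP k) (DeltaP j) ∧
      POrdered (SigmaP k) (DeltaP j) = PAnyOrder (SigmaP k) (DeltaP j) ∧
      PAnyOrder (SigmaP k) (DeltaP j) =
        if k < j then DeltaP j else POnePoly (SigmaP k) (SigmaP (j - 1))) ∧
    (∀ j k : ℕ,
      PParallel (DeltaP j) (SigmaP k ∩ PiP k) = POrdered (DeltaP j) (SigmaP k ∩ PiP k) ∧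
      POrdered (DeltaP j) (SigmaP k ∩ PiP k) = POrdered (SigmaP k ∩ PiP k) (DeltaP j) ∧
      POrdered (SigmaP k ∩ PiP k) (DeltaP j) = PAnyOrder (SigmaP k ∩ PiP k) (DeltaP j) ∧
      PAnyOrder (SigmaP k ∩ PiP k) (DeltaP j) =
        if k < j then DeltaP j else SigmaP k ∩ PiP k) ∧
    (∀ j k : ℕ,
      PParallel (SigmaP j ∩ PiP j) (SigmaP k ∩ PiP k) =
        POrdered (SigmaP j ∩ PiP j) (SigmaP k ∩ PiP k) ∧
      POrdered (SigmaP j ∩ PiP j) (SigmaP k ∩ PiP k) =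
        POrdered (SigmaP k ∩ PiP k) (SigmaP j ∩ PiP j) ∧
      POrdered (SigmaP k ∩ PiP k) (SigmaP j ∩ PiP j) =
        PAnyOrder (SigmaP k ∩ PiP k) (SigmaP j ∩ PiP j) ∧
      PAnyOrder (SigmaP k ∩ PiP k) (SigmaP j ∩ PiP j) =
        SigmaP (max j k) ∩ PiP (max j k)) := by
  refine ⟨fun j k hj => ?_, fun j k => ?_, fun j k => ?_⟩
  · obtain ⟨m, rfl⟩ : ∃ m, j = m + 1 := ⟨j - 1, by omega⟩
    split_ifs with hkj
    · have hk := sigma_subset_delta hkj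
      exact classes_eq_of_mem
        (fun R _ => ⟨PTwo_subset_delta subset_rfl hk, PTwo_subset_delta hk subset_rfl⟩)
        (delta_nonempty _) ((sigma_inter_pi_nonempty k).mono Set.inter_subset_left)
        (.inl subset_rfl)
    · have hjk : m + 1 ≤ k := by omega
      -- The upper bound needs only one query to `Σ_k^p`; the queries to the other oracle, in `Σ_m^p
      -- ⊆ Δ_{m+1}^p`, may be many.
      have hpoly : POnePoly (SigmaP k) (SigmaP (m + 1 - 1)) =
          {L | ∃ B ∈ DeltaP (m + 1), ∃ C ∈ SigmaP k, L = symmDiff B C} := by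
        refine (PTwo_subset_symmDiff_left allowsOnce_onePoly hj hjk
          (sigma_subset_delta_succ m)).antisymm ?_
        rintro _ ⟨B, hB, C, hC, rfl⟩
        rw [symmDiff_comm]
        exact symmDiff_mem_POnePoly hC hB
      rw [hpoly]
      refine classes_eq (fun R hR => ⟨PTwo_subset_symmDiff_right (hR 1) hj hjk subset_rfl,
        PTwo_subset_symmDiff_left (hR 0) hj hjk subset_rfl⟩) ?_ ?_ ?_
      · rintro _ ⟨B, hB, C, hC, rfl⟩
        exact symmDiff_mem_PParallel hB hC
      · rintro _ ⟨B, hB, C, hC, rfl⟩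
        exact symmDiff_mem_POrdered hB hC
      · rintro _ ⟨B, hB, C, hC, rfl⟩
        rw [symmDiff_comm]
        exact symmDiff_mem_POrdered hC hB
  · split_ifs with hkj
    · obtain ⟨m, rfl⟩ : ∃ m, j = m + 1 := ⟨j - 1, by omega⟩
      have hk : SigmaP k ∩ PiP k ⊆ DeltaP (m + 1) :=
        Set.inter_subset_left.trans (sigma_subset_delta hkj)
      exact classes_eq_of_mem
        (fun R _ => ⟨PTwo_subset_delta subset_rfl hk, PTwo_subset_delta hk subset_rfl⟩)
        (delta_nonempty _) (sigma_inter_pi_nonempty k) (.inl subset_rfl)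
    · have hj := (delta_subset_sigma_inter_pi j).trans (sigma_inter_pi_mono (not_lt.1 hkj))
      exact classes_eq_of_mem
        (fun R hR => ⟨PTwo_subset_sigma_inter_pi hR hj subset_rfl,
          PTwo_subset_sigma_inter_pi hR subset_rfl hj⟩)
        (delta_nonempty _) (sigma_inter_pi_nonempty k) (.inr subset_rfl)
  · have hj := sigma_inter_pi_mono (le_max_left j k)
    have hk := sigma_inter_pi_mono (le_max_right j k)
    refine classes_eq_of_mem
      (fun R hR => ⟨PTwo_subset_sigma_inter_pi hR hj hk, PTwo_subset_sigma_inter_pi hR hk hj⟩)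
      (sigma_inter_pi_nonempty j) (sigma_inter_pi_nonempty k) ?_
    rcases max_choice j k with h | h
    · exact .inl (by rw [h])
    · exact .inr (by rw [h])
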